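/- Let $\mathrm{Vir}$ be the complex Virasoro algebra, with basis $z$, $e_j$ ($j\in\mathbb Z$), $z$ central and $[e_j,e_k]=(k-j)e_{j+k}+\delta_{k,-j}\frac{j^3-j}{12}z$. For a polynomial $f\in\mathbb C[t]$ let $\mathrm{Vir}^f$ be the subalgebra of all $x\in\mathrm{Vir}$ whose image under the linear map $\mathrm{Vir}\to\mathbb C[t^{\pm1}]$, $e_j\mapsto t^j$, $z\mapsto 0$, lies in the ideal of $\mathbb C[t^{\pm1}]$ generated by $f$. For a Lie algebra homomorphism $\mu:\mathrm{Vir}^f\to\mathbb C$ let $V^f_\mu=U(\mathrm{Vir})\otimes_{U(\mathrm{Vir}^f)}\mathbb C_\mu$ be the $\mathrm{Vir}$-module induced from the corresponding one-dimensional module. A $\mathrm{Vir}$-module $V$ is called $\mathrm{Vir}^+$-locally annihilated if every $v\in V$ satisfies $\mathrm{Vir}_{\ge L}v=0$ for some integer $L\ge 0$, where $\mathrm{Vir}_{\ge L}=\mathrm{span}\{z,e_j\mid j\ge L\}$. (a) Let $k,\ell\ge 0$ be integers. Let $\lambda_1,\dots,\lambda_k\in\mathbb C^\times$ be distinct, $n_1,\dots,n_k\ge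 1$ integers, $f_i=t-\lambda_i$, and $\mu_i:\mathrm{Vir}^{f_i^{n_i}}\to\mathbb C$ homomorphisms. Let $\gamma_1,\dots,\gamma_\ell\in\mathbb C^\times$ be distinct, $m_1,\dots,m_\ell\ge 1$ integers, $g_i=t-\gamma_i$, and $\theta_i:\mathrm{Vir}^{g_i^{m_i}}\to\mathbb C$ homomorphisms. Let $V$ and $W$ be simple $\mathrm{Vir}^+$-locally annihilated $\mathrm{Vir}$-modules. Then $$\bigotimes_{i=1}^k V^{f_i^{n_i}}_{\mu_i}\otimes V\;\cong\;\bigotimes_{i=1}^\ell V^{g_i^{m_i}}_{\theta_i}\otimes W$$ as $\mathrm{Vir}$-modules if and only if $V\cong W$, $k=\ell$, and there is a bijection $\sigma:\{1,\dots,k\}\to\{1,\dots,\ell\}$ such that $\lambda_i=\gamma_{\sigma(i)}$, $n_i=m_{\sigma(i)}$ and $\mu_i=\theta_{\sigma(i)}$ for all $i$. (b) For $\lambda\in\mathbb C^\times$ and $b\in\mathbb C$ let $\Omega(\lambda,b)=\mathbb C[\partial]$ be the $\mathrm{Vir}$-module on which $z$ acts by $0$ and $e_k\,\partial^n=\lambda^k(\partial+k(b-1))(\partial-k)^n$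 for $k\in\mathbb Z$, $n\ge 0$. If $f\in\mathbb C[t]$ is monic with nonzero constant term and $\deg f\ne 1$, then for every homomorphism $\mu:\mathrm{Vir}^f\to\mathbb C$ and all $\lambda\in\mathbb C^\times$, $b\in\mathbb C$, the module $V^f_\mu$ is not isomorphic to $\Omega(\lambda,b)$. -/

import Mathlib

open scoped TensorProduct LaurentPolynomial Polynomial

noncomputable section

/-! ### Tensor products of finite families of Lie modules -/

section PiTensor

variable (R : Type*) {L ι : Type*} [CommRing R] [LieRing L] [LieAlgebra R L] [DecidableEq ι]
variable (M : ι → Type*) [∀ i, AddCommGroup (M i)] [∀ i, Module R (M i)]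
variable [∀ i, LieRingModule L (M i)] [∀ i, LieModule R L (M i)]

/-- The action of `x` on the `i`-th tensor factor, the other factors being left unchanged. -/
def lieFactor (x : L) (i : ι) : Module.End R (⨂[R] j, M j) :=
  PiTensorProduct.map (Pi.mulSingle i (LieModule.toEnd R L (M i) x))

/-- The diagonal action of a Lie algebra on a finite tensor product of modules:
`x (v₁ ⊗ ⋯ ⊗ vₖ) = ∑ᵢ v₁ ⊗ ⋯ ⊗ x vᵢ ⊗ ⋯ ⊗ vₖ`. -/
def lieDiagonal [Fintype ι] (x : L) : Module.End R (⨂[R] j, M j) :=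
  ∑ i, lieFactor R M x i

theorem lieFactor_tprod (x : L) (i : ι) (v : ∀ j, M j) :
    lieFactor R M x i (PiTensorProduct.tprod R v) =
      PiTensorProduct.tprod R (Function.update v i ⁅x, v i⁆) := by
  rw [lieFactor, PiTensorProduct.map_tprod]
  congr 1
  funext j
  by_cases h : j = i
  · subst h; simp
  · simp [h]

theorem lieDiagonal_tprod [Fintype ι] (x : L) (v : ∀ j, M j) :
    lieDiagonal R M x (PiTensorProduct.tprod R v) =
      ∑ i, PiTensorProduct.tprod R (Function.update v i ⁅x, v i⁆) := by
  simp [lieDiagonal, lieFactor_tprod]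

theorem lieFactor_add (x y : L) (i : ι) :
    lieFactor R M (x + y) i = lieFactor R M x i + lieFactor R M y i := by
  simp only [lieFactor, map_add, Pi.mulSingle]
  exact PiTensorProduct.map_update_add _ _ _ _

theorem lieFactor_smul (c : R) (x : L) (i : ι) :
    lieFactor R M (c • x) i = c • lieFactor R M x i := by
  simp only [lieFactor, map_smul, Pi.mulSingle]
  exact PiTensorProduct.map_update_smul _ _ _ _

theorem lieFactor_comm (x y : L) {i j : ι} (h : i ≠ j) :
    lieFactor R M x i * lieFactor R M y j = lieFactor R M y j * lieFactor R M x i := by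
  have := (Pi.mulSingle_commute (f := fun i => Module.End R (M i)) h
    (LieModule.toEnd R L (M i) x) (LieModule.toEnd R L (M j) y)).map
      (PiTensorProduct.mapMonoidHom (R := R) (s := M))
  exact this.eq

theorem lieFactor_lie (x y : L) (i : ι) :
    lieFactor R M ⁅x, y⁆ i =
      lieFactor R M x i * lieFactor R M y i - lieFactor R M y i * lieFactor R M x i := by
  rw [eq_sub_iff_add_eq]
  ext v
  simp only [LinearMap.compMultilinearMap_apply, LinearMap.add_apply, Module.End.mul_apply,
    lieFactor_tprod, Function.update_self, Function.update_idem]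
  rw [← MultilinearMap.map_update_add, lie_lie, sub_add_cancel]

theorem lieDiagonal_lie [Fintype ι] (x y : L) :
    lieDiagonal R M ⁅x, y⁆ =
      lieDiagonal R M x * lieDiagonal R M y - lieDiagonal R M y * lieDiagonal R M x := by
  simp only [lieDiagonal, Finset.sum_mul_sum]
  rw [Finset.sum_comm (f := fun i j => lieFactor R M y i * lieFactor R M x j),
    ← Finset.sum_sub_distrib]
  refine Finset.sum_congr rfl fun i _ => ?_
  rw [← Finset.sum_sub_distrib, Finset.sum_eq_single i]
  · exact lieFactor_lie R M x y i
  · intro j _ h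
    rw [lieFactor_comm R M x y h.symm, sub_self]
  · simp

instance piTensorLieRingModule [Fintype ι] : LieRingModule L (⨂[R] j, M j) where
  bracket x v := lieDiagonal R M x v
  add_lie x y v := by
    change lieDiagonal R M (x + y) v = lieDiagonal R M x v + lieDiagonal R M y v
    simp [lieDiagonal, lieFactor_add, Finset.sum_add_distrib]
  lie_add x v w := map_add _ v w
  leibniz_lie x y v := by
    change lieDiagonal R M x (lieDiagonal R M y v) =
      lieDiagonal R M ⁅x, y⁆ v + lieDiagonal R M y (lieDiagonal R M x v)
    simp [lieDiagonal_lie]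

instance piTensorLieModule [Fintype ι] : LieModule R L (⨂[R] j, M j) where
  smul_lie c x v := by
    change lieDiagonal R M (c • x) v = c • lieDiagonal R M x v
    simp [lieDiagonal, lieFactor_smul, Finset.smul_sum]
  lie_smul c x v := map_smul (lieDiagonal R M x) c v

end PiTensor

/-! ### Modules induced from one-dimensional modules -/

section Induced

attribute [local instance 100] LieRing.ofAssociativeRing

variable {R L : Type*} [CommRing R] [LieRing L] [LieAlgebra R L]

/-- The left ideal of `U(L)` generated by the elements `h - μ(h)`, `h ∈ H`. -/
def inducedIdeal (H : LieSubalgebra R L) (μ : LieAlgebra.LieCharacter R H) :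
    Submodule (UniversalEnvelopingAlgebra R L) (UniversalEnvelopingAlgebra R L) :=
  Submodule.span (UniversalEnvelopingAlgebra R L) (Set.range fun h : H =>
    UniversalEnvelopingAlgebra.ι R (h : L) -
      algebraMap R (UniversalEnvelopingAlgebra R L) (μ h))

/-- The induced module `U(L) ⊗_{U(H)} R_μ`, where `R_μ` is `R` with `h ∈ H` acting as `μ(h)`.
As `R_μ` is generated by `1`, subject to the relations `h 1 = μ(h) 1`, this is the quotient of
`U(L)` by the left ideal generated by the elements `h - μ(h)`, with `u ⊗ 1` the class of `u`. -/
def InducedModule (H : LieSubalgebra R L) (μ : LieAlgebra.LieCharacter R H) :=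
  UniversalEnvelopingAlgebra R L ⧸ inducedIdeal H μ

namespace InducedModule

variable (H : LieSubalgebra R L) (μ : LieAlgebra.LieCharacter R H)

instance : AddCommGroup (InducedModule H μ) :=
  inferInstanceAs (AddCommGroup (UniversalEnvelopingAlgebra R L ⧸ inducedIdeal H μ))

instance : Module (UniversalEnvelopingAlgebra R L) (InducedModule H μ) :=
  inferInstanceAs (Module (UniversalEnvelopingAlgebra R L)
    (UniversalEnvelopingAlgebra R L ⧸ inducedIdeal H μ))

instance : Module R (InducedModule H μ) :=
  inferInstanceAs (Module R (UniversalEnvelopingAlgebra R L ⧸ inducedIdeal H μ))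

instance : IsScalarTower R (UniversalEnvelopingAlgebra R L) (InducedModule H μ) :=
  inferInstanceAs (IsScalarTower R (UniversalEnvelopingAlgebra R L)
    (UniversalEnvelopingAlgebra R L ⧸ inducedIdeal H μ))

instance : LieRingModule L (InducedModule H μ) where
  bracket x v := UniversalEnvelopingAlgebra.ι R x • v
  add_lie x y v := by
    change UniversalEnvelopingAlgebra.ι R (x + y) • v = _ • v + _ • v
    rw [map_add, add_smul]
  lie_add x v w := smul_add _ v w
  leibniz_lie x y v := by
    change UniversalEnvelopingAlgebra.ι R x • UniversalEnvelopingAlgebra.ι R y • v =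
      UniversalEnvelopingAlgebra.ι R ⁅x, y⁆ • v +
        UniversalEnvelopingAlgebra.ι R y • UniversalEnvelopingAlgebra.ι R x • v
    rw [LieHom.map_lie, LieRing.of_associative_ring_bracket, sub_smul, mul_smul, mul_smul,
      sub_add_cancel]

instance : LieModule R L (InducedModule H μ) where
  smul_lie c x v := by
    change UniversalEnvelopingAlgebra.ι R (c • x) • v = c • UniversalEnvelopingAlgebra.ι R x • v
    rw [map_smul, smul_assoc]
  lie_smul c x v := by
    change UniversalEnvelopingAlgebra.ι R x • c • v = c • UniversalEnvelopingAlgebra.ι R x • v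
    rw [smul_algebra_smul_comm]

end InducedModule

end Induced

/-! ### The Virasoro algebra -/

/-- The Virasoro algebra, with basis `e j` (`j ∈ ℤ`) and `z`. -/
def Virasoro : Type := (ℤ →₀ ℂ) × ℂ

namespace Virasoro

instance : AddCommGroup Virasoro := inferInstanceAs (AddCommGroup ((ℤ →₀ ℂ) × ℂ))

instance : Module ℂ Virasoro := inferInstanceAs (Module ℂ ((ℤ →₀ ℂ) × ℂ))

/-- The basis vector `e_j`. -/
def e (j : ℤ) : Virasoro := (Finsupp.single j 1, 0)

/-- The central basis vector `z`. -/
def z : Virasoro := ((0 : ℤ →₀ ℂ), (1 : ℂ))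

/-- The linear projection onto the span of the `e_j` along `z`. -/
def eCoeffs : Virasoro →ₗ[ℂ] (ℤ →₀ ℂ) := LinearMap.fst ℂ (ℤ →₀ ℂ) ℂ

/-- The bracket `[e_j, e_k] = (k - j) e_{j+k} + δ_{k,-j} (j³ - j)/12 z`. -/
def basisBracket (j k : ℤ) : Virasoro :=
  ((k : ℂ) - j) • e (j + k) + if k = -j then (((j : ℂ) ^ 3 - j) / 12) • z else 0

/-- The bilinear extension of the bracket of the `e_j`. -/
def bracketAux : (ℤ →₀ ℂ) →ₗ[ℂ] (ℤ →₀ ℂ) →ₗ[ℂ] Virasoro :=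
  Finsupp.linearCombination ℂ fun j => Finsupp.linearCombination ℂ fun k => basisBracket j k

instance : Bracket Virasoro Virasoro where
  bracket x y := bracketAux (eCoeffs x) (eCoeffs y)

theorem lie_def (x y : Virasoro) : ⁅x, y⁆ = bracketAux (eCoeffs x) (eCoeffs y) := rfl

@[simp] theorem eCoeffs_e (j : ℤ) : eCoeffs (e j) = Finsupp.single j 1 := rfl

@[simp] theorem eCoeffs_z : eCoeffs z = 0 := rfl

@[simp] theorem bracketAux_single (j k : ℤ) (a b : ℂ) :
    bracketAux (Finsupp.single j a) (Finsupp.single k b) = (a * b) • basisBracket j k := by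
  simp [bracketAux, Finsupp.linearCombination_single, smul_smul]

theorem bracket_e_e (j k : ℤ) : ⁅e j, e k⁆ =
    ((k : ℂ) - j) • e (j + k) + if k = -j then (((j : ℂ) ^ 3 - j) / 12) • z else 0 := by
  simp [lie_def, basisBracket]

theorem bracket_z_left (x : Virasoro) : ⁅z, x⁆ = 0 := by simp [lie_def]

theorem eCoeffs_basisBracket (j k : ℤ) :
    eCoeffs (basisBracket j k) = Finsupp.single (j + k) ((k : ℂ) - j) := by
  unfold basisBracket
  split_ifs <;> simp

theorem basisBracket_antisymm (j k : ℤ) : basisBracket j k + basisBracket k j = 0 := by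
  unfold basisBracket
  by_cases h : k = -j
  · subst h
    simp only [if_true, neg_neg, add_neg_cancel, neg_add_cancel]
    push_cast
    module
  · have h' : ¬ j = -k := by omega
    simp only [h, h', if_false, add_comm k j]
    module

theorem bracketAux_antisymm (f g : ℤ →₀ ℂ) : bracketAux f g + bracketAux g f = 0 := by
  induction f using Finsupp.induction_linear with
  | zero => simp
  | add f₁ f₂ h₁ h₂ =>
    simp only [map_add, LinearMap.add_apply]
    rw [add_add_add_comm, h₁, h₂, add_zero]
  | single j a =>
    induction g using Finsupp.induction_linear with
    | zero => simp
    | add g₁ g₂ h₁ h₂ =>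
      simp only [map_add, LinearMap.add_apply]
      rw [add_add_add_comm, h₁, h₂, add_zero]
    | single k b =>
      rw [bracketAux_single, bracketAux_single, mul_comm b a, ← smul_add, basisBracket_antisymm,
        smul_zero]

theorem basisBracket_jacobi (j k l : ℤ) :
    ((l : ℂ) - k) • basisBracket j (k + l) =
      ((k : ℂ) - j) • basisBracket (j + k) l + ((l : ℂ) - j) • basisBracket k (j + l) := by
  unfold basisBracket
  rw [← add_assoc j k l, ← add_assoc k j l, add_comm k j]
  by_cases h : l = -(j + k)
  · subst h
    simp only [show k + -(j + k) = -j by ring, show j + -(j + k) = -k by ring, if_true]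
    push_cast
    module
  · have h₁ : ¬ k + l = -j := by omega
    have h₂ : ¬ j + l = -k := by omega
    simp only [h, h₁, h₂, if_false]
    push_cast
    module

theorem bracketAux_jacobi (f g h : ℤ →₀ ℂ) :
    bracketAux f (eCoeffs (bracketAux g h)) =
      bracketAux (eCoeffs (bracketAux f g)) h + bracketAux g (eCoeffs (bracketAux f h)) := by
  induction f using Finsupp.induction_linear with
  | zero => simp
  | add f₁ f₂ h₁ h₂ =>
    simp only [map_add, LinearMap.add_apply, h₁, h₂]
    abel
  | single j a =>
    induction g using Finsupp.induction_linear with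
    | zero => simp
    | add g₁ g₂ h₁ h₂ =>
      simp only [map_add, LinearMap.add_apply, h₁, h₂]
      abel
    | single k b =>
      induction h using Finsupp.induction_linear with
      | zero => simp
      | add g₁ g₂ h₁ h₂ =>
        simp only [map_add, h₁, h₂]
        abel
      | single l c =>
        have := congrArg (fun v => (a * b * c) • v) (basisBracket_jacobi j k l)
        simp only [bracketAux_single, map_smul, eCoeffs_basisBracket, LinearMap.smul_apply,
          smul_smul, smul_add] at this ⊢
        convert this using 2 <;> ring_nf

instance : LieRing Virasoro where
  add_lie x y w := by simp [lie_def]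
  lie_add x y w := by simp [lie_def]
  lie_self x := by
    have h := bracketAux_antisymm (eCoeffs x) (eCoeffs x)
    rw [← two_smul ℂ] at h
    exact (smul_eq_zero.mp h).resolve_left two_ne_zero
  leibniz_lie x y w := bracketAux_jacobi _ _ _

instance : LieAlgebra ℂ Virasoro where
  lie_smul c x y := by simp [lie_def]

/-! ### Polynomial subalgebras -/

/-- The projection of the Virasoro algebra onto `ℂ[t, t⁻¹]` with `e_j ↦ t^j` and `z ↦ 0`. -/
def toLaurent : Virasoro →ₗ[ℂ] ℂ[T;T⁻¹] :=
  (Finsupp.linearCombination ℂ fun j => LaurentPolynomial.T j) ∘ₗ eCoeffs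

/-- The operator `t d/dt` on Laurent polynomials. -/
def euler : ℂ[T;T⁻¹] →ₗ[ℂ] ℂ[T;T⁻¹] :=
  (Finsupp.linearCombination ℂ fun j : ℤ => (j : ℂ) • LaurentPolynomial.T j) ∘ₗ
    (AddMonoidAlgebra.coeffLinearEquiv ℂ).toLinearMap

theorem euler_T (j : ℤ) :
    euler (LaurentPolynomial.T j) = (j : ℂ) • (LaurentPolynomial.T j : ℂ[T;T⁻¹]) := by
  have h : AddMonoidAlgebra.coeffLinearEquiv ℂ (LaurentPolynomial.T j : ℂ[T;T⁻¹]) =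
      Finsupp.single j 1 := rfl
  rw [euler, LinearMap.comp_apply, LinearEquiv.coe_coe, h, Finsupp.linearCombination_single,
    one_smul]

theorem laurent_induction {P : ℂ[T;T⁻¹] → Prop} (p : ℂ[T;T⁻¹])
    (hadd : ∀ p q, P p → P q → P (p + q))
    (hT : ∀ (n : ℤ) (a : ℂ), P (a • LaurentPolynomial.T n)) : P p := by
  induction p using LaurentPolynomial.induction_on' with
  | add p q hp hq => exact hadd p q hp hq
  | C_mul_T n a => simpa [LaurentPolynomial.smul_eq_C_mul] using hT n a

theorem euler_mul (p q : ℂ[T;T⁻¹]) : euler (p * q) = p * euler q + euler p * q := by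
  induction p using laurent_induction with
  | hadd p₁ p₂ h₁ h₂ => rw [add_mul, map_add, h₁, h₂, map_add]; ring
  | hT m a =>
    induction q using laurent_induction with
    | hadd q₁ q₂ h₁ h₂ => rw [mul_add, map_add, h₁, h₂, map_add]; ring
    | hT n b =>
      simp only [smul_mul_assoc, mul_smul_comm, map_smul, euler_T, ← LaurentPolynomial.T_add]
      push_cast
      module

theorem toLaurent_e (j : ℤ) : toLaurent (e j) = LaurentPolynomial.T j := by
  simp [toLaurent]

/-- The projection intertwines the bracket with `[f, g] = t (f g' - g f')`. -/
theorem toLaurent_lie (x y : Virasoro) :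
    toLaurent ⁅x, y⁆ =
      toLaurent x * euler (toLaurent y) - toLaurent y * euler (toLaurent x) := by
  simp only [toLaurent, LinearMap.comp_apply, lie_def]
  generalize eCoeffs x = f
  generalize eCoeffs y = g
  induction f using Finsupp.induction_linear with
  | zero => simp
  | add f₁ f₂ h₁ h₂ =>
    simp only [map_add, LinearMap.add_apply, h₁, h₂]
    ring
  | single j a =>
    induction g using Finsupp.induction_linear with
    | zero => simp
    | add g₁ g₂ h₁ h₂ =>
      simp only [map_add, h₁, h₂]
      ring
    | single k b =>
      simp only [bracketAux_single, map_smul, eCoeffs_basisBracket,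
        Finsupp.linearCombination_single, euler_T, smul_mul_assoc, mul_smul_comm,
        ← LaurentPolynomial.T_add, add_comm k j]
      module

/-- The polynomial subalgebra `Vir^f`: all `x` whose image in `ℂ[t, t⁻¹]` is a multiple of `f`. -/
def polySubalgebra (f : ℂ[X]) : LieSubalgebra ℂ Virasoro where
  carrier := {x | toLaurent x ∈ Ideal.span {Polynomial.toLaurent f}}
  add_mem' {x y} hx hy := by
    simpa only [Set.mem_ofPred_eq, map_add] using Ideal.add_mem _ hx hy
  zero_mem' := by simp
  smul_mem' c x hx := by
    simp only [Set.mem_ofPred_eq, map_smul, LaurentPolynomial.smul_eq_C_mul] at hx ⊢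
    exact Ideal.mul_mem_left _ _ hx
  lie_mem' {x y} hx hy := by
    change toLaurent ⁅x, y⁆ ∈ Ideal.span {Polynomial.toLaurent f}
    rw [toLaurent_lie]
    exact Ideal.sub_mem _ (Ideal.mul_mem_right _ _ hx) (Ideal.mul_mem_right _ _ hy)

theorem mem_polySubalgebra (f : ℂ[X]) (x : Virasoro) :
    x ∈ polySubalgebra f ↔ toLaurent x ∈ Ideal.span {Polynomial.toLaurent f} := Iff.rfl

/-- The module `V^f_μ` induced from the one-dimensional module of `Vir^f` given by `μ`. -/
abbrev polyModule (f : ℂ[X]) (μ : LieAlgebra.LieCharacter ℂ (polySubalgebra f)) : Type :=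
  InducedModule (polySubalgebra f) μ

/-! ### Locally annihilated modules -/

/-- The subspace `Vir_{≥ N}` spanned by `z` and the `e_j` with `j ≥ N`. -/
def geSpan (N : ℕ) : Submodule ℂ Virasoro :=
  Submodule.span ℂ ({z} ∪ {x | ∃ j : ℤ, (N : ℤ) ≤ j ∧ x = e j})

/-- Every vector is annihilated by some `Vir_{≥ N}`. -/
def IsLocallyAnnihilated (V : Type*) [AddCommGroup V] [LieRingModule Virasoro V] : Prop :=
  ∀ v : V, ∃ N : ℕ, ∀ x ∈ geSpan N, ⁅x, v⁆ = 0

/-! ### The modules `Ω(lam, b)` -/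

/-- The underlying space of `Ω(lam, b)`: polynomials in the variable `∂`. -/
@[nolint unusedArguments]
def Omega (_lam : ℂˣ) (_b : ℂ) : Type := ℂ[X]

namespace Omega

variable (lam : ℂˣ) (b : ℂ)

instance : AddCommGroup (Omega lam b) := inferInstanceAs (AddCommGroup ℂ[X])

instance : Module ℂ (Omega lam b) := inferInstanceAs (Module ℂ ℂ[X])

/-- The operator `p(∂) ↦ lam^k (∂ + k (b - 1)) p(∂ - k)`, by which `e_k` acts. -/
def eAct (k : ℤ) : Module.End ℂ ℂ[X] :=
  ((lam : ℂ) ^ k) •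
    (LinearMap.mulLeft ℂ (Polynomial.X + Polynomial.C ((k : ℂ) * (b - 1))) ∘ₗ
      Polynomial.taylor (-(k : ℂ)))

theorem eAct_apply (k : ℤ) (p : ℂ[X]) : eAct lam b k p =
    ((lam : ℂ) ^ k) • ((Polynomial.X + Polynomial.C ((k : ℂ) * (b - 1))) *
      p.comp (Polynomial.X - Polynomial.C (k : ℂ))) := by
  simp [eAct, Polynomial.taylor_apply, sub_eq_add_neg]

/-- The action of the Virasoro algebra on `Ω(lam, b)`, with `z` acting as `0`. -/
def act : Virasoro →ₗ[ℂ] Module.End ℂ ℂ[X] :=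
  (Finsupp.linearCombination ℂ (eAct lam b)) ∘ₗ eCoeffs

theorem eAct_comm (j k : ℤ) (p : ℂ[X]) :
    eAct lam b j (eAct lam b k p) - eAct lam b k (eAct lam b j p) =
      ((k : ℂ) - j) • eAct lam b (j + k) p := by
  have hl : (lam : ℂ) ≠ 0 := lam.ne_zero
  have h₁ : (p.comp (Polynomial.X - Polynomial.C (k : ℂ))).comp
      (Polynomial.X - Polynomial.C (j : ℂ)) =
        p.comp (Polynomial.X - Polynomial.C (j : ℂ) - Polynomial.C (k : ℂ)) := by
    simp [Polynomial.comp_assoc]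
  have h₂ : (p.comp (Polynomial.X - Polynomial.C (j : ℂ))).comp
      (Polynomial.X - Polynomial.C (k : ℂ)) =
        p.comp (Polynomial.X - Polynomial.C (j : ℂ) - Polynomial.C (k : ℂ)) := by
    simp only [Polynomial.comp_assoc, Polynomial.sub_comp, Polynomial.X_comp, Polynomial.C_comp]
    rw [sub_right_comm]
  have h₃ : Polynomial.X - Polynomial.C ((j + k : ℤ) : ℂ) =
      Polynomial.X - Polynomial.C (j : ℂ) - Polynomial.C (k : ℂ) := by
    push_cast; rw [Polynomial.C_add]; ring
  simp only [eAct_apply, Polynomial.mul_comp, h₁, h₂, h₃,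
    Polynomial.add_comp, Polynomial.sub_comp, Polynomial.X_comp, Polynomial.C_comp,
    Polynomial.smul_eq_C_mul, zpow_add₀ hl, Polynomial.C_mul, Polynomial.C_sub]
  push_cast
  simp only [Polynomial.C_add]
  ring

theorem act_lie (x y : Virasoro) (p : ℂ[X]) :
    act lam b x (act lam b y p) - act lam b y (act lam b x p) = act lam b ⁅x, y⁆ p := by
  simp only [act, LinearMap.comp_apply, lie_def]
  generalize eCoeffs x = f
  generalize eCoeffs y = g
  induction f using Finsupp.induction_linear with
  | zero => simp
  | add f₁ f₂ h₁ h₂ =>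
    simp only [map_add, LinearMap.add_apply, ← h₁, ← h₂]
    abel
  | single j a =>
    induction g using Finsupp.induction_linear with
    | zero => simp
    | add g₁ g₂ h₁ h₂ =>
      simp only [map_add, LinearMap.add_apply, ← h₁, ← h₂]
      abel
    | single k c =>
      have := eAct_comm lam b j k p
      simp only [bracketAux_single, map_smul, eCoeffs_basisBracket,
        Finsupp.linearCombination_single, LinearMap.smul_apply]
      rw [← this]
      module

instance : LieRingModule Virasoro (Omega lam b) where
  bracket x p := act lam b x p
  add_lie x y p := by
    change act lam b (x + y) p = act lam b x p + act lam b y p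
    rw [map_add]; rfl
  lie_add x p q := map_add (act lam b x) p q
  leibniz_lie x y p := by
    change act lam b x (act lam b y p) = act lam b ⁅x, y⁆ p + act lam b y (act lam b x p)
    exact sub_eq_iff_eq_add.mp (act_lie lam b x y p)

instance : LieModule ℂ Virasoro (Omega lam b) where
  smul_lie c x p := by
    change act lam b (c • x) p = c • act lam b x p
    rw [map_smul]; rfl
  lie_smul c x p := map_smul (act lam b x) c p

theorem act_e (k : ℤ) (p : ℂ[X]) : act lam b (e k) p =
    ((lam : ℂ) ^ k) • ((Polynomial.X + Polynomial.C ((k : ℂ) * (b - 1))) *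
      p.comp (Polynomial.X - Polynomial.C (k : ℂ))) := by
  rw [← eAct_apply]
  simp [act]

theorem act_z : act lam b z = 0 := by
  simp [act]

end Omega

end Virasoro

end

/-! Modulo `z`, an element of Vir is a Laurent polynomial, and Vir^(f^n) with f = t - λ consists of
the elements vanishing to order n at λ. A locally annihilated module plays the same role at the
point 0.

Locality. A character of Vir^(f^n) vanishes on Vir^(f^(2n)), since f(0) ≠ 0, and a bracket loses at
most one order of vanishing. Hence every vector of V^(f^n)_μ is killed by all elements vanishing to
high order at λ (`exists_annihilator`). By the Chinese remainder theorem an element can be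
approximated at one point and made small at finitely many others (`exists_approximation`). So the
action on each tensor factor is determined by the Vir-module structure of the whole product, and
every homomorphism respects the factor actions point by point (`LocalDecomposition.map_slot`). The
points must agree, because e_0 acts nontrivially on each induced factor. At the point 0, contracting
with a functional gives a nonzero map V → W, to which Schur's lemma applies.

Spectra. On V^(f^n)_μ an element x of Vir^(f^n) kills each vector by a nonzero polynomial with roots
in μ(x) + ℕc, where c does not depend on μ and is 0 for n ≥ 2 (`exists_spectral_progression`). For m
< n, no nonzero polynomial in the element f^m kills the generator (`aeval_pow_gen_ne_zero`). This
contrast determines n. If μ(x) ∈ θ(x) + ℕc and θ(x) ∈ μ(x) + ℕc, then μ(x) = θ(x), as the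
characteristic is zero.

Freeness. The non-annihilation statement usually rests on the Poincaré–Birkhoff–Witt theorem. Here
it comes from a chain Vir^f ⊂ ... ⊂ Vir that drops one root of f at a time. In each step K = H ⊕ F
y, and a representation N of H extends to N[y] (`LieSubalgebra.IsRepOn.exists_extension`). The
universal property maps the induced module to the representation reached at the top.

Part (b). The generator would go to a polynomial p that is an eigenvector of Vir^f. An element x
changes the top coefficient by the factor x(λ) while raising the degree by one, so f = 1 or f(λ) =
0. If f has a second root, t - λ preserves a finite-dimensional space of polynomials containing p,
so its characteristic polynomial kills p, against freeness. If f = 1, the module has dimension at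
most one. -/

noncomputable section

/-! ### Induction of representations one dimension at a time -/

section PartialRepresentations

variable {F L : Type*} [Field F] [LieRing L] [LieAlgebra F L]

/-- A linear map `ρ : L → End N` is a representation on the subalgebra `H` if it respects brackets
of elements of `H`. Its values outside `H` play no role. -/
def LieSubalgebra.IsRepOn (H : LieSubalgebra F L) {N : Type*} [AddCommGroup N] [Module F N]
    (ρ : L →ₗ[F] Module.End F N) : Prop :=
  ∀ x ∈ H, ∀ y ∈ H, ∀ v, ρ ⁅x, y⁆ v = ρ x (ρ y v) - ρ y (ρ x v)

namespace LieExtension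

variable {N : Type*} [AddCommGroup N] [Module F N]

/-- The linear map `x ↦ ⁅x, y⁆`. -/
def bracketRight (y : L) : L →ₗ[F] L where
  toFun x := ⁅x, y⁆
  map_add' := by simp
  map_smul' := by simp

/-- The shift `y^j ⊗ n ↦ y^(j+1) ⊗ n` on `N[y]`. -/
def shift : Module.End F (ℕ →₀ N) := Finsupp.lmapDomain N F Nat.succ

theorem shift_single (j : ℕ) (n : N) :
    shift (F := F) (Finsupp.single j n) = Finsupp.single (j + 1) n := by
  simp [shift]

variable (ρ : L →ₗ[F] Module.End F N) (y : L) (P : L →ₗ[F] L) (α : L →ₗ[F] F)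

/-- The vectors `x · (y^j ⊗ n)` of `N[y]`, for `x` in a subalgebra complementary to `y`, obtained
by moving `x` past the powers of `y`. -/
def actPow : ℕ → L →ₗ[F] N →ₗ[F] (ℕ →₀ N)
  | 0 => LinearMap.llcomp F N N (ℕ →₀ N) (Finsupp.lsingle 0) ∘ₗ ρ
  -- This is x y^(j+1) = y x y^j + [x, y] y^j, with [x, y] split into its component under `P` and
  -- its multiple `α` of y.
  | j + 1 => LinearMap.llcomp F N (ℕ →₀ N) (ℕ →₀ N) shift ∘ₗ actPow j +
      actPow j ∘ₗ P ∘ₗ bracketRight y +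
      (α ∘ₗ bracketRight y).smulRight (Finsupp.lsingle (j + 1))

/-- The operators on `N[y]` given by `actPow`. -/
def actAux : L →ₗ[F] Module.End F (ℕ →₀ N) where
  toFun x := Finsupp.lsum F fun j => actPow ρ y P α j x
  map_add' x x' := by ext; simp
  map_smul' c x := by ext; simp

/-- The action on `N[y]` induced from the action `ρ` on `N`. -/
def act : L →ₗ[F] Module.End F (ℕ →₀ N) := actAux ρ y P α ∘ₗ P + α.smulRight shift

theorem actAux_single (x : L) (j : ℕ) (n : N) :
    actAux ρ y P α x (Finsupp.single j n) = actPow ρ y P α j x n := by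
  simp [actAux]

theorem act_apply (x : L) (v : ℕ →₀ N) :
    act ρ y P α x v = actAux ρ y P α (P x) v + α x • shift (F := F) v := by
  simp [act]

/-- The recursion defining `actPow` is exactly the relation x y = y x + [x, y]. The bracket acts
through the full `act`, since it may have a component along y. -/
theorem actAux_shift (x : L) (v : ℕ →₀ N) :
    actAux ρ y P α x (shift (F := F) v) =
      shift (F := F) (actAux ρ y P α x v) + act ρ y P α ⁅x, y⁆ v := by
  induction v using Finsupp.induction_linear with
  | zero => simp
  | add v w hv hw => simp only [map_add, hv, hw]; abel
  | single j n =>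
    rw [shift_single, actAux_single, act_apply, actAux_single, actAux_single, shift_single]
    simp [actPow, bracketRight, add_assoc]

variable {ρ y P α} {H K : LieSubalgebra F L}

theorem act_eq_actAux (hα : ∀ x ∈ H, P x = x ∧ α x = 0) {x : L} (hx : x ∈ H) (v : ℕ →₀ N) :
    act ρ y P α x v = actAux ρ y P α x v := by
  simp [act_apply, hα x hx]

theorem act_generator (hy : P y = 0) (hy' : α y = 1) (v : ℕ →₀ N) :
    act ρ y P α y v = shift (F := F) v := by
  simp [act_apply, hy, hy']

/-- The component of x in H is covered by `hv`, the component along y by `actAux_shift`. The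
hypothesis concerns the single vector v because the induction in `isRepOn_act` knows the relations
on H only one degree in y at a time. -/
theorem act_lie_of_mem (hα : ∀ x ∈ H, P x = x ∧ α x = 0)
    (hy : P y = 0) (hy' : α y = 1) {v : ℕ →₀ N}
    (hv : ∀ x ∈ H, ∀ x' ∈ H, act ρ y P α ⁅x, x'⁆ v =
      act ρ y P α x (act ρ y P α x' v) - act ρ y P α x' (act ρ y P α x v))
    (hP : ∀ x ∈ K, P x ∈ H ∧ x = P x + α x • y) {x x' : L} (hx : x ∈ K) (hx' : x' ∈ H) :
    act ρ y P α ⁅x, x'⁆ v =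
      act ρ y P α x (act ρ y P α x' v) - act ρ y P α x' (act ρ y P α x v) := by
  obtain ⟨h1, h2⟩ := hP x hx
  have h3 := hv _ h1 _ hx'
  have h4 := actAux_shift ρ y P α x' v
  rw [← act_eq_actAux hα hx', ← act_eq_actAux hα hx'] at h4
  rw [h2]
  simp only [add_lie, smul_lie, map_add, map_smul, LinearMap.add_apply, LinearMap.smul_apply, h3,
    act_generator hy hy', h4, ← lie_skew y x', map_neg, LinearMap.neg_apply]
  module

/-- For pairs in H the proof is by induction on the degree in y: both sides are moved past one
factor y and compared by the Jacobi identity. The brackets [x, y] lie only in K, so the relation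
between K and H on the vector of lower degree is needed. Pairs in K then follow by bilinearity and
antisymmetry. -/
theorem isRepOn_act (hα : ∀ x ∈ H, P x = x ∧ α x = 0)
    (hy : P y = 0) (hy' : α y = 1) (hP : ∀ x ∈ K, P x ∈ H ∧ x = P x + α x • y)
    (hHK : H ≤ K) (hyK : y ∈ K) (hρ : H.IsRepOn ρ) : K.IsRepOn (act ρ y P α) := by
  have key : ∀ v : ℕ →₀ N, ∀ x ∈ H, ∀ x' ∈ H, act ρ y P α ⁅x, x'⁆ v =
      act ρ y P α x (act ρ y P α x' v) - act ρ y P α x' (act ρ y P α x v) := by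
    intro v
    induction v using Finsupp.induction_linear with
    | zero => simp
    | add v w hv hw =>
      intro x hx x' hx'
      simp only [map_add, hv x hx x' hx', hw x hx x' hx']
      abel
    | single j n =>
      induction j with
      | zero =>
        intro x hx x' hx'
        rw [act_eq_actAux hα (H.lie_mem hx hx'), act_eq_actAux hα hx', act_eq_actAux hα hx',
          act_eq_actAux hα hx, act_eq_actAux hα hx]
        simp only [actAux_single, actPow, LinearMap.comp_apply, LinearMap.llcomp_apply,
          Finsupp.lsingle_apply, hρ x hx x' hx', Finsupp.single_sub]
      | succ j ih =>
        intro x hx x' hx'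
        rw [← shift_single (F := F)]
        generalize Finsupp.single j n = w at ih
        have mixed : ∀ u ∈ K, ∀ u' ∈ H, act ρ y P α ⁅u, u'⁆ w =
            act ρ y P α u (act ρ y P α u' w) - act ρ y P α u' (act ρ y P α u w) :=
          fun u hu u' hu' => act_lie_of_mem hα hy hy' ih hP hu hu'
        have sh : ∀ u ∈ H, ∀ w', act ρ y P α u (shift (F := F) w') =
            shift (F := F) (act ρ y P α u w') + act ρ y P α ⁅u, y⁆ w' := by
          intro u hu w'
          rw [act_eq_actAux hα hu, act_eq_actAux hα hu, actAux_shift]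
        have jac : ⁅⁅x, x'⁆, y⁆ = ⁅⁅x, y⁆, x'⁆ - ⁅⁅x', y⁆, x⁆ := by
          rw [lie_lie, ← lie_skew ⁅x', y⁆ x, ← lie_skew ⁅x, y⁆ x']
          abel
        rw [sh _ (H.lie_mem hx hx'), sh _ hx', sh _ hx, map_add, map_add, sh _ hx', sh _ hx, jac,
          map_sub, LinearMap.sub_apply, mixed _ (K.lie_mem (hHK hx) hyK) _ hx',
          mixed _ (K.lie_mem (hHK hx') hyK) _ hx, ih x hx x' hx', map_sub]
        abel
  intro x hx x' hx' v
  obtain ⟨h1, h2⟩ := hP x' hx'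
  have h3 := act_lie_of_mem hα hy hy' (key v) hP hx h1
  have h4 := act_lie_of_mem hα hy hy' (key v) hP hyK (hP x hx).1
  obtain ⟨h5, h6⟩ := hP x hx
  have h7 : ⁅x, y⁆ = - ⁅y, P x⁆ := by
    conv_lhs => rw [h6]
    simp [add_lie]
  have h8 : act ρ y P α x (shift (F := F) v) =
      act ρ y P α (P x) (shift (F := F) v) + α x • shift (F := F) (shift (F := F) v) := by
    conv_lhs => rw [h6]
    simp [act_generator hy hy']
  have h9 : act ρ y P α x v = act ρ y P α (P x) v + α x • shift (F := F) v := by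
    conv_lhs => rw [h6]
    simp [act_generator hy hy']
  rw [act_generator hy hy', act_generator hy hy'] at h4
  rw [h2]
  simp only [lie_add, lie_smul, map_add, map_smul, LinearMap.add_apply, LinearMap.smul_apply, h3,
    act_generator hy hy', h7, map_neg, LinearMap.neg_apply, h4, h8]
  rw [h9]
  simp only [map_add, map_smul]
  module

theorem act_single_zero (hα : ∀ x ∈ H, P x = x ∧ α x = 0) {x : L} (hx : x ∈ H) (n : N) :
    act ρ y P α x (Finsupp.single 0 n) = Finsupp.single 0 (ρ x n) := by
  rw [act_eq_actAux hα hx, actAux_single]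
  simp [actPow]

theorem shift_pow_single (j : ℕ) (n : N) :
    (shift (F := F) ^ j) (Finsupp.single 0 n) = Finsupp.single j n := by
  induction j with
  | zero => simp
  | succ j ih => rw [pow_succ', Module.End.mul_apply, ih, shift_single]

end LieExtension

/-- If `K = H ⊕ F y` then every representation `N` of `H` embeds into a representation of `K` in
which the nonzero polynomials in `y` do not annihilate any nonzero vector of `N`. -/
theorem LieSubalgebra.IsRepOn.exists_extension {H K : LieSubalgebra F L} {y : L} (hHK : H ≤ K)
    (hyK : y ∈ K) (hyH : y ∉ H) (hK : ∀ x ∈ K, ∃ c : F, x - c • y ∈ H)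
    {N : Type*} [AddCommGroup N] [Module F N] {ρ : L →ₗ[F] Module.End F N} (hρ : H.IsRepOn ρ) :
    ∃ (ρ' : L →ₗ[F] Module.End F (ℕ →₀ N)) (i : N →ₗ[F] (ℕ →₀ N)), K.IsRepOn ρ' ∧
      Function.Injective i ∧ (∀ x ∈ H, ∀ v, ρ' x (i v) = i (ρ x v)) ∧
      ∀ p : F[X], p ≠ 0 → ∀ v, v ≠ 0 → Polynomial.aeval (ρ' y) p (i v) ≠ 0 := by
  obtain ⟨α, hα1, hα2⟩ := Submodule.exists_dual_map_eq_bot_of_notMem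
    (p := H.toSubmodule) (x := y) hyH inferInstance
  have hα0 : ∀ x ∈ H, α x = 0 := by
    intro x hx
    have : α x ∈ H.toSubmodule.map α := ⟨x, hx, rfl⟩
    rwa [hα2, Submodule.mem_bot] at this
  -- Normalized so that y ↦ 1 and H ↦ 0; then `P` below is the projection of K onto H along y.
  set β : L →ₗ[F] F := (α y)⁻¹ • α with hβ
  have hβ0 : ∀ x ∈ H, β x = 0 := fun x hx => by simp [hβ, hα0 x hx]
  have hβ1 : β y = 1 := by simp [hβ, hα1]
  set P : L →ₗ[F] L := LinearMap.id - β.smulRight y with hPdef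
  have hPx : ∀ x, P x = x - β x • y := fun x => by simp [hPdef]
  have h1 : ∀ x ∈ H, P x = x ∧ β x = 0 := fun x hx => by simp [hPx, hβ0 x hx]
  have h2 : P y = 0 := by simp [hPx, hβ1]
  have h3 : ∀ x ∈ K, P x ∈ H ∧ x = P x + β x • y := by
    intro x hx
    refine ⟨?_, by rw [hPx]; abel⟩
    obtain ⟨c, hc⟩ := hK x hx
    have := hβ0 _ hc
    rw [map_sub, map_smul, hβ1, smul_eq_mul, mul_one, sub_eq_zero] at this
    rwa [hPx, this]
  refine ⟨LieExtension.act ρ y P β, Finsupp.lsingle 0,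
    LieExtension.isRepOn_act h1 h2 hβ1 h3 hHK hyK hρ, Finsupp.single_injective 0,
    fun x hx v => LieExtension.act_single_zero h1 hx v, ?_⟩
  intro p hp v hv
  have h4 : LieExtension.act ρ y P β y = LieExtension.shift :=
    LinearMap.ext fun w => LieExtension.act_generator h2 hβ1 w
  intro h0
  apply hp
  -- As y acts by the shift, the coefficient of y^j in p(y) v is p_j v.
  rw [h4, Polynomial.aeval_eq_sum_range, LinearMap.sum_apply] at h0
  simp only [LinearMap.smul_apply, Finsupp.lsingle_apply, LieExtension.shift_pow_single] at h0
  ext j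
  rw [Polynomial.coeff_zero]
  by_cases hj : j ≤ p.natDegree
  · have := DFunLike.congr_fun h0 j
    rw [Finsupp.finsetSum_apply, Finset.sum_eq_single j] at this
    · simpa [hv] using this
    · intro b _ hb
      simp [hb]
    · intro h; simp at h; omega
  · exact Polynomial.coeff_eq_zero_of_natDegree_lt (by omega)

end PartialRepresentations

/-! ### Generalities on induced modules -/

section Induced

attribute [local instance 100] LieRing.ofAssociativeRing

theorem LinearMap.map_aeval_apply {R M N : Type*} [CommRing R] [AddCommGroup M] [Module R M]
    [AddCommGroup N] [Module R N] {A : Module.End R M} {B : Module.End R N} {φ : M →ₗ[R] N}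
    (h : ∀ v, φ (A v) = B (φ v)) (p : R[X]) (v : M) :
    φ (Polynomial.aeval A p v) = Polynomial.aeval B p (φ v) := by
  induction p using Polynomial.induction_on' generalizing v with
  | add p q hp hq => simp [hp, hq]
  | monomial n a =>
    have : ∀ n : ℕ, φ ((A ^ n) v) = (B ^ n) (φ v) := by
      intro n
      induction n with
      | zero => simp
      | succ n ih => rw [pow_succ', pow_succ', Module.End.mul_apply, h, ih, Module.End.mul_apply]
    simp [Polynomial.aeval_monomial, this]

/-- `ι` lifts to an algebra map into the generated subalgebra; followed by the inclusion it is the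
identity, by uniqueness in the universal property. -/
theorem UniversalEnvelopingAlgebra.adjoin_range_ι (R L : Type*) [CommRing R] [LieRing L]
    [LieAlgebra R L] :
    Algebra.adjoin R (Set.range (UniversalEnvelopingAlgebra.ι R (L := L))) = ⊤ := by
  set S := Algebra.adjoin R (Set.range (UniversalEnvelopingAlgebra.ι R (L := L)))
  let f : L →ₗ⁅R⁆ S :=
    { toFun := fun x => ⟨UniversalEnvelopingAlgebra.ι R x, Algebra.subset_adjoin ⟨x, rfl⟩⟩
      map_add' := fun x y => Subtype.ext (by simp)
      map_smul' := fun c x => Subtype.ext (by simp)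
      map_lie' := fun {x y} => Subtype.ext (by
        simp [LieRing.of_associative_ring_bracket]) }
  have h : S.val.comp (UniversalEnvelopingAlgebra.lift R f) =
      AlgHom.id R (UniversalEnvelopingAlgebra R L) := by
    ext x
    simp [f]
  rw [eq_top_iff]
  intro u _
  have := DFunLike.congr_fun h u
  simp only [AlgHom.comp_apply, AlgHom.id_apply] at this
  rw [← this]
  exact (UniversalEnvelopingAlgebra.lift R f u).2

namespace InducedModule

variable {R L : Type*} [CommRing R] [LieRing L] [LieAlgebra R L]
variable (H : LieSubalgebra R L) (μ : LieAlgebra.LieCharacter R H)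

/-- The generator `1 ⊗ 1` of an induced module. -/
def gen : InducedModule H μ := Submodule.Quotient.mk (p := inducedIdeal H μ) 1

variable {H μ}

theorem lie_def (x : L) (v : InducedModule H μ) :
    ⁅x, v⁆ = UniversalEnvelopingAlgebra.ι R x • v := rfl

theorem smul_gen (u : UniversalEnvelopingAlgebra R L) :
    u • gen H μ = Submodule.Quotient.mk (p := inducedIdeal H μ) u := by
  change Submodule.Quotient.mk (p := inducedIdeal H μ) (u * 1) = _
  rw [mul_one]

theorem lie_gen {x : L} (hx : x ∈ H) : ⁅x, gen H μ⁆ = μ ⟨x, hx⟩ • gen H μ := by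
  rw [lie_def, ← algebraMap_smul (UniversalEnvelopingAlgebra R L), smul_gen, smul_gen]
  exact (Submodule.Quotient.eq (inducedIdeal H μ)).mpr (Submodule.subset_span ⟨⟨x, hx⟩, rfl⟩)

/-- An induced module is generated by its generator. -/
theorem induction {S : Submodule R (InducedModule H μ)} (hgen : gen H μ ∈ S)
    (hlie : ∀ (x : L), ∀ v ∈ S, ⁅x, v⁆ ∈ S) (v : InducedModule H μ) : v ∈ S := by
  have key : ∀ u : UniversalEnvelopingAlgebra R L, ∀ v ∈ S, u • v ∈ S := by
    intro u
    have hu : u ∈ Algebra.adjoin R (Set.range (UniversalEnvelopingAlgebra.ι R (L := L))) := by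
      rw [UniversalEnvelopingAlgebra.adjoin_range_ι]; trivial
    induction hu using Algebra.adjoin_induction with
    | mem u hu => obtain ⟨x, rfl⟩ := hu; exact hlie x
    | algebraMap r => intro v hv; rw [algebraMap_smul]; exact S.smul_mem _ hv
    | add a b _ _ ha hb => intro v hv; rw [add_smul]; exact S.add_mem (ha v hv) (hb v hv)
    | mul a b _ _ ha hb => intro v hv; rw [mul_smul]; exact ha _ (hb v hv)
  obtain ⟨u, rfl⟩ := Submodule.Quotient.mk_surjective (inducedIdeal H μ) v
  rw [← smul_gen]
  exact key u _ hgen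

end InducedModule

/-- The universal property of induced modules. -/
theorem InducedModule.exists_hom {F L : Type*} [Field F] [LieRing L] [LieAlgebra F L]
    {H : LieSubalgebra F L} {μ : LieAlgebra.LieCharacter F H} {N : Type*} [AddCommGroup N]
    [Module F N] {ρ : L →ₗ[F] Module.End F N} (hρ : (⊤ : LieSubalgebra F L).IsRepOn ρ) {v : N}
    (hv : ∀ x (hx : x ∈ H), ρ x v = μ ⟨x, hx⟩ • v) :
    ∃ φ : InducedModule H μ →ₗ[F] N, φ (gen H μ) = v ∧ ∀ x w, φ ⁅x, w⁆ = ρ x (φ w) := by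
  let f : L →ₗ⁅F⁆ Module.End F N :=
    { ρ with
      map_lie' := fun {x y} => LinearMap.ext fun w => by
        simpa [LieRing.of_associative_ring_bracket] using hρ x trivial y trivial w }
  set Φ := UniversalEnvelopingAlgebra.lift F f with hΦ
  have hΦι : ∀ x, Φ (UniversalEnvelopingAlgebra.ι F x) = ρ x := fun x => by
    rw [hΦ, UniversalEnvelopingAlgebra.lift_ι_apply]; rfl
  have hker : (inducedIdeal H μ).restrictScalars F ≤
      LinearMap.ker ((LinearMap.applyₗ v) ∘ₗ Φ.toLinearMap) := by
    intro u hu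
    rw [Submodule.restrictScalars_mem] at hu
    change Φ u v = 0
    induction hu using Submodule.span_induction with
    | mem u hu =>
      obtain ⟨x, rfl⟩ := hu
      rw [map_sub, hΦι, AlgHom.commutes, LinearMap.sub_apply, hv x x.2, Module.algebraMap_end_apply,
        sub_self]
    | zero => simp
    | add a b _ _ ha hb => simp [ha, hb]
    | smul a b _ hb => simp [hb]
  refine ⟨Submodule.liftQ ((inducedIdeal H μ).restrictScalars F) _ hker, ?_, ?_⟩
  · change Φ 1 v = v
    simp
  · intro x w
    obtain ⟨u, rfl⟩ := Submodule.Quotient.mk_surjective (inducedIdeal H μ) w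
    change Φ (UniversalEnvelopingAlgebra.ι F x * u) v = ρ x (Φ u v)
    rw [map_mul, hΦι, Module.End.mul_apply]

end Induced

/-! ### Polynomial subalgebras of the Virasoro algebra -/

namespace Virasoro

/-- The linear section `t^j ↦ e_j` of the projection to Laurent polynomials. -/
def ofLaurent : ℂ[T;T⁻¹] →ₗ[ℂ] Virasoro :=
  LinearMap.inl ℂ (ℤ →₀ ℂ) ℂ ∘ₗ (AddMonoidAlgebra.coeffLinearEquiv ℂ).toLinearMap

theorem ofLaurent_T (j : ℤ) : ofLaurent (LaurentPolynomial.T j) = e j := rfl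

theorem toLaurent_ofLaurent (p : ℂ[T;T⁻¹]) : toLaurent (ofLaurent p) = p := by
  induction p using laurent_induction with
  | hadd p q hp hq => rw [map_add, map_add, hp, hq]
  | hT n a => rw [map_smul, map_smul, ofLaurent_T, toLaurent_e]

theorem toLaurent_z : toLaurent z = 0 := by simp [toLaurent]

theorem coeff_toLaurent (x : Virasoro) :
    AddMonoidAlgebra.coeffLinearEquiv ℂ (toLaurent x) = eCoeffs x := by
  rw [toLaurent, LinearMap.comp_apply]
  generalize eCoeffs x = f
  induction f using Finsupp.induction_linear with
  | zero => simp
  | add f g hf hg => rw [map_add, map_add, hf, hg]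
  | single j a =>
    rw [Finsupp.linearCombination_single, map_smul]
    exact Finsupp.smul_single_one j a

theorem eq_ofLaurent_add (x : Virasoro) : x = ofLaurent (toLaurent x) + x.2 • z := by
  refine Prod.ext ?_ ?_
  · change x.1 = AddMonoidAlgebra.coeffLinearEquiv ℂ (toLaurent x) + x.2 • (0 : ℤ →₀ ℂ)
    rw [coeff_toLaurent, smul_zero, add_zero]
    rfl
  · change x.2 = 0 + x.2 * 1
    ring

theorem mem_polySubalgebra_iff_dvd {f : ℂ[X]} {x : Virasoro} :
    x ∈ polySubalgebra f ↔ Polynomial.toLaurent f ∣ toLaurent x := by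
  rw [mem_polySubalgebra, Ideal.mem_span_singleton]

theorem polySubalgebra_mono {f g : ℂ[X]} (h : g ∣ f) : polySubalgebra f ≤ polySubalgebra g := by
  intro x hx
  rw [mem_polySubalgebra_iff_dvd] at hx ⊢
  exact (map_dvd _ h).trans hx

theorem polySubalgebra_one : polySubalgebra 1 = ⊤ := by
  rw [eq_top_iff]
  intro x _
  rw [mem_polySubalgebra_iff_dvd, map_one]
  exact one_dvd _

theorem ofLaurent_mem (g : ℂ[X]) : ofLaurent (Polynomial.toLaurent g) ∈ polySubalgebra g := by
  rw [mem_polySubalgebra_iff_dvd, toLaurent_ofLaurent]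

/-- Evaluation of Laurent polynomials at a nonzero point. -/
abbrev evalAt (a : ℂˣ) : ℂ[T;T⁻¹] →+* ℂ := LaurentPolynomial.eval₂ (RingHom.id ℂ) a

theorem evalAt_toLaurent (a : ℂˣ) (p : ℂ[X]) : evalAt a (Polynomial.toLaurent p) = p.eval (a : ℂ) := by
  rw [LaurentPolynomial.eval₂_toLaurent, Polynomial.eval₂_id]

theorem toLaurent_dvd_of_evalAt_eq_zero {a : ℂˣ} {s : ℂ[T;T⁻¹]} (h : evalAt a s = 0) :
    Polynomial.toLaurent (Polynomial.X - Polynomial.C (a : ℂ)) ∣ s := by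
  obtain ⟨n, p, hp⟩ := s.exists_T_pow
  have h1 : p.eval (a : ℂ) = 0 := by rw [← evalAt_toLaurent, hp, map_mul, h, zero_mul]
  have h2 : Polynomial.toLaurent (Polynomial.X - Polynomial.C (a : ℂ)) ∣
      s * LaurentPolynomial.T n := by
    rw [← hp]
    exact map_dvd _ (Polynomial.dvd_iff_isRoot.mpr h1)
  exact (LaurentPolynomial.isUnit_T (n : ℤ)).dvd_mul_right.mp h2

/-- If x projects to g s, the constant is s(a), since s - s(a) is divisible by t - a. Together with
`ofLaurent_notMem`, the element g spans a complement of Vir^(g(t-a)) in Vir^g. -/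
theorem exists_sub_smul_mem {g : ℂ[X]} (a : ℂˣ) {x : Virasoro} (hx : x ∈ polySubalgebra g) :
    ∃ c : ℂ, x - c • ofLaurent (Polynomial.toLaurent g) ∈
      polySubalgebra (g * (Polynomial.X - Polynomial.C (a : ℂ))) := by
  obtain ⟨s, hs⟩ := mem_polySubalgebra_iff_dvd.mp hx
  refine ⟨evalAt a s, ?_⟩
  rw [mem_polySubalgebra_iff_dvd, map_sub, map_smul, toLaurent_ofLaurent, hs, map_mul,
    LaurentPolynomial.smul_eq_C_mul, mul_comm (LaurentPolynomial.C _), ← mul_sub]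
  refine mul_dvd_mul_left _ (toLaurent_dvd_of_evalAt_eq_zero ?_)
  simp

theorem ofLaurent_notMem {g : ℂ[X]} (hg : g ≠ 0) (a : ℂˣ) :
    ofLaurent (Polynomial.toLaurent g) ∉
      polySubalgebra (g * (Polynomial.X - Polynomial.C (a : ℂ))) := by
  rw [mem_polySubalgebra_iff_dvd, toLaurent_ofLaurent, map_mul]
  rintro ⟨s, hs⟩
  have h1 : Polynomial.toLaurent g *
      (Polynomial.toLaurent (Polynomial.X - Polynomial.C (a : ℂ)) * s) =
        Polynomial.toLaurent g * 1 := by rw [← mul_assoc, ← hs, mul_one]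
  have h2 := congrArg (evalAt a) (mul_left_cancel₀ (Polynomial.toLaurent_ne_zero.mpr hg) h1)
  rw [map_mul, evalAt_toLaurent] at h2
  simp at h2

/-- The monic polynomial with the given nonzero roots. -/
def rootProd (s : Multiset ℂˣ) : ℂ[X] :=
  (s.map fun a : ℂˣ => Polynomial.X - Polynomial.C (a : ℂ)).prod

theorem rootProd_cons (a : ℂˣ) (s : Multiset ℂˣ) :
    rootProd (a ::ₘ s) = (Polynomial.X - Polynomial.C (a : ℂ)) * rootProd s := by
  simp [rootProd]

theorem rootProd_ne_zero (s : Multiset ℂˣ) : rootProd s ≠ 0 := by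
  refine Multiset.prod_ne_zero fun h => ?_
  obtain ⟨b, _, hb⟩ := Multiset.mem_map.mp h
  exact Polynomial.X_sub_C_ne_zero _ hb

/-- The roots in s are dropped one at a time, each time by a codimension-one extension. -/
theorem exists_extension_prod (s : Multiset ℂˣ) {g : ℂ[X]} (hg : g ≠ 0) {N : Type}
    [AddCommGroup N] [Module ℂ N] {ρ : Virasoro →ₗ[ℂ] Module.End ℂ N}
    (hρ : (polySubalgebra
      (g * rootProd s)).IsRepOn ρ) :
    ∃ (N' : Type) (_ : AddCommGroup N') (_ : Module ℂ N')
      (ρ' : Virasoro →ₗ[ℂ] Module.End ℂ N') (i : N →ₗ[ℂ] N'),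
      (polySubalgebra g).IsRepOn ρ' ∧ Function.Injective i ∧
      ∀ x ∈ polySubalgebra (g * rootProd s),
        ∀ v, ρ' x (i v) = i (ρ x v) := by
  induction s using Multiset.induction_on generalizing N with
  | empty =>
    refine ⟨N, inferInstance, inferInstance, ρ, LinearMap.id, by simpa [rootProd] using hρ,
      Function.injective_id, by simp⟩
  | cons a s ih =>
    have hq : g * rootProd (a ::ₘ s) =
        g * rootProd s *
          (Polynomial.X - Polynomial.C (a : ℂ)) := by
      rw [rootProd_cons]; ring
    rw [hq] at hρ ⊢
    set q := g * rootProd s with hqdef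
    have hq0 : q ≠ 0 := mul_ne_zero hg (rootProd_ne_zero s)
    have hle := polySubalgebra_mono (Dvd.intro (Polynomial.X - Polynomial.C (a : ℂ)) rfl : q ∣ _)
    obtain ⟨ρ₁, i₁, h1, h2, h3, -⟩ := LieSubalgebra.IsRepOn.exists_extension hle (ofLaurent_mem q)
      (ofLaurent_notMem hq0 a) (fun x hx => exists_sub_smul_mem a hx) hρ
    obtain ⟨N', _, _, ρ', i', h4, h5, h6⟩ := ih h1
    refine ⟨N', inferInstance, inferInstance, ρ', i' ∘ₗ i₁, h4, h5.comp h2, ?_⟩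
    intro x hx v
    rw [LinearMap.comp_apply, h6 x (hle hx), h3 x hx, LinearMap.comp_apply]

/-- If `f = g (t - a) q`, where `a` and the roots of `q` are nonzero, then no nonzero polynomial
in the element of the Virasoro algebra given by `g` annihilates the generator of `V^f_μ`. -/
theorem aeval_gen_ne_zero {f g : ℂ[X]} (hg : g ≠ 0) (a : ℂˣ) (s : Multiset ℂˣ)
    (s' : Multiset ℂˣ) (hs' : g = rootProd s')
    (hf : f = g * (Polynomial.X - Polynomial.C (a : ℂ)) *
      rootProd s)
    (μ : LieAlgebra.LieCharacter ℂ (polySubalgebra f)) {p : ℂ[X]} (hp : p ≠ 0) :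
    Polynomial.aeval (LieModule.toEnd ℂ Virasoro (polyModule f μ)
      (ofLaurent (Polynomial.toLaurent g))) p (InducedModule.gen (polySubalgebra f) μ) ≠ 0 := by
  -- A linear extension of μ to all of Vir; only its values on Vir^f matter.
  obtain ⟨ν, hν⟩ := LinearMap.exists_extend (p := (polySubalgebra f).toSubmodule)
    (μ : polySubalgebra f →ₗ[ℂ] ℂ)
  have hν' : ∀ x (hx : x ∈ polySubalgebra f), ν x = μ ⟨x, hx⟩ := fun x hx =>
    DFunLike.congr_fun hν ⟨x, hx⟩
  let ρ₀ : Virasoro →ₗ[ℂ] Module.End ℂ ℂ := LinearMap.smulRight ν LinearMap.id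
  have h0 : (polySubalgebra f).IsRepOn ρ₀ := by
    intro x hx y hy v
    have h1 : ν ⁅x, y⁆ = 0 := by
      rw [hν' _ ((polySubalgebra f).lie_mem hx hy)]
      exact LieAlgebra.lieCharacter_apply_lie μ ⟨x, hx⟩ ⟨y, hy⟩
    simp [ρ₀, h1]
    ring
  subst hf
  have hle : polySubalgebra (g * (Polynomial.X - Polynomial.C (a : ℂ)) * rootProd s) ≤ polySubalgebra (g * (Polynomial.X - Polynomial.C (a : ℂ))) :=
    polySubalgebra_mono (Dvd.intro _ rfl)
  have hle' : polySubalgebra (g * (Polynomial.X - Polynomial.C (a : ℂ))) ≤ polySubalgebra g := polySubalgebra_mono (Dvd.intro _ rfl)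
  -- The one-dimensional module is extended from Vir^f to Vir^(g(t-a)), then by the single element g
  -- to Vir^g, where polynomials in g act freely, and finally to Vir. The last embedding is
  -- equivariant for Vir^g, hence for g, so the freeness survives.
  obtain ⟨N₁, _, _, ρ₁, i₁, h1, h2, h3⟩ := exists_extension_prod s
    (mul_ne_zero hg (Polynomial.X_sub_C_ne_zero _)) h0
  obtain ⟨ρ₂, i₂, h4, h5, h6, h7⟩ := LieSubalgebra.IsRepOn.exists_extension hle' (ofLaurent_mem g)
    (ofLaurent_notMem hg a) (fun x hx => exists_sub_smul_mem a hx) h1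
  have h4' : (polySubalgebra (1 * rootProd s')).IsRepOn ρ₂ := by
    rwa [one_mul, ← hs']
  obtain ⟨N₃, _, _, ρ₃, i₃, h8, h9, h10⟩ := exists_extension_prod s' one_ne_zero h4'
  rw [one_mul, ← hs'] at h10
  rw [polySubalgebra_one] at h8
  obtain ⟨φ, hφ1, hφ2⟩ := InducedModule.exists_hom (μ := μ) h8 (v := i₃ (i₂ (i₁ 1))) (by
    intro x hx
    rw [h10 x (hle' (hle hx)), h6 x (hle hx), h3 x hx]
    simp [ρ₀, hν' x hx, ← map_smul])
  intro hcontra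
  have h11 := congrArg φ hcontra
  rw [LinearMap.map_aeval_apply (B := ρ₃ (ofLaurent (Polynomial.toLaurent g)))
    (fun v => hφ2 _ v), map_zero, hφ1,
    ← LinearMap.map_aeval_apply (A := ρ₂ (ofLaurent (Polynomial.toLaurent g))) (φ := i₃)
      (fun v => (h10 _ (ofLaurent_mem g) v).symm)] at h11
  refine h7 p hp (i₁ 1) ?_ (h9 (h11.trans (map_zero _).symm))
  exact fun h => one_ne_zero (h2 (h.trans (map_zero _).symm))

end Virasoro

/-! ### Orders of vanishing and local annihilation -/

namespace Virasoro

/-- A derivation lowers the order of vanishing by at most one. -/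
theorem pow_dvd_euler (p s : ℂ[T;T⁻¹]) (k : ℕ) : p ^ k ∣ euler (p ^ (k + 1) * s) := by
  have h (n : ℕ) : p ^ (n + 1) * s = p * (p ^ n * s) := by ring
  rw [h, euler_mul]
  refine dvd_add ?_ (dvd_mul_of_dvd_right (dvd_mul_right _ _) _)
  induction k with
  | zero => rw [pow_zero]; exact one_dvd _
  | succ k ih =>
    rw [pow_succ' p k]
    refine mul_dvd_mul_left _ ?_
    rw [mul_assoc, euler_mul]
    exact dvd_add ih (dvd_mul_of_dvd_right (dvd_mul_right _ _) _)

/-- Each term of t (f g' - g f') contains one derivative, so a bracket of elements of orders i and k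
has order at least i + k - 1. The hypothesis is written without truncated subtraction. -/
theorem lie_mem_polySubalgebra_pow {p : ℂ[X]} {i k m : ℕ} (h : m + 1 ≤ i + k) {x y : Virasoro}
    (hx : x ∈ polySubalgebra (p ^ i)) (hy : y ∈ polySubalgebra (p ^ k)) :
    ⁅x, y⁆ ∈ polySubalgebra (p ^ m) := by
  rw [mem_polySubalgebra_iff_dvd, map_pow] at hx hy ⊢
  obtain ⟨s, hs⟩ := hx
  obtain ⟨r, hr⟩ := hy
  rw [toLaurent_lie, hs, hr]
  set q := Polynomial.toLaurent p
  have key : ∀ (i k : ℕ) (s r : ℂ[T;T⁻¹]), m + 1 ≤ i + k →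
      q ^ m ∣ q ^ i * s * euler (q ^ k * r) := by
    intro i k s r h
    cases k with
    | zero =>
      exact (pow_dvd_pow q (by omega)).trans ((dvd_mul_right _ _).trans (dvd_mul_right _ _))
    | succ k =>
      refine (pow_dvd_pow q (by omega : m ≤ i + k)).trans ?_
      rw [pow_add]
      exact mul_dvd_mul (dvd_mul_right _ _) (pow_dvd_euler q r k)
  exact dvd_sub (key i k s r h) (key k i r s (by omega))

theorem mem_polySubalgebra_pow_zero (p : ℂ[X]) (x : Virasoro) : x ∈ polySubalgebra (p ^ 0) := by
  rw [pow_zero, polySubalgebra_one]; trivial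

theorem z_mem_polySubalgebra (f : ℂ[X]) : z ∈ polySubalgebra f := by
  rw [mem_polySubalgebra_iff_dvd, toLaurent_z]
  exact dvd_zero _

/-- Exponents m + j and n - j with m, n ≥ 0 sum to zero only for m = n = 0, so the cocycle sees only
the constant terms. -/
theorem lie_ofLaurent_snd (f g : ℂ[X]) (j : ℤ) :
    (⁅ofLaurent (Polynomial.toLaurent f * LaurentPolynomial.T j),
      ofLaurent (Polynomial.toLaurent g * LaurentPolynomial.T (-j))⁆ : Virasoro).2 =
      f.coeff 0 * g.coeff 0 * (((j : ℂ) ^ 3 - j) / 12) := by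
  have hadd : ∀ u v : Virasoro, (u + v).2 = u.2 + v.2 := fun _ _ => rfl
  induction f using Polynomial.induction_on' with
  | add f₁ f₂ h₁ h₂ =>
    rw [map_add, add_mul, map_add, add_lie, hadd, h₁, h₂, Polynomial.coeff_add]
    ring
  | monomial m a =>
    induction g using Polynomial.induction_on' with
    | add g₁ g₂ h₁ h₂ =>
      rw [map_add, add_mul, map_add, lie_add, hadd, h₁, h₂, Polynomial.coeff_add]
      ring
    | monomial n b =>
      rw [Polynomial.toLaurent_C_mul_T, Polynomial.toLaurent_C_mul_T, mul_assoc, mul_assoc,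
        ← LaurentPolynomial.T_add, ← LaurentPolynomial.T_add, ← LaurentPolynomial.smul_eq_C_mul,
        ← LaurentPolynomial.smul_eq_C_mul, map_smul, map_smul, ofLaurent_T, ofLaurent_T,
        smul_lie, lie_smul, bracket_e_e]
      change a * (b * (((((n + -j : ℤ) : ℂ) - ((m + j : ℤ) : ℂ)) * 0 : ℂ) + Prod.snd _)) = _
      by_cases h : m = 0 ∧ n = 0
      · obtain ⟨rfl, rfl⟩ := h
        simp only [Nat.cast_zero, zero_add, if_true, Polynomial.coeff_monomial]
        change a * (b * (_ + ((j : ℂ) ^ 3 - j) / 12 * 1)) = _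
        ring
      · rw [if_neg (by omega), Polynomial.coeff_monomial, Polynomial.coeff_monomial]
        change a * (b * (_ + 0)) = _
        rcases not_and_or.mp h with h | h <;> simp [h]

theorem lie_ofLaurent_mul_T (f : ℂ[X]) (j k : ℤ) :
    ⁅ofLaurent (Polynomial.toLaurent f * LaurentPolynomial.T j),
      ofLaurent (Polynomial.toLaurent f * LaurentPolynomial.T k)⁆ =
      ((k : ℂ) - j) • ofLaurent (Polynomial.toLaurent (f ^ 2) * LaurentPolynomial.T (j + k)) +
      (⁅ofLaurent (Polynomial.toLaurent f * LaurentPolynomial.T j),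
        ofLaurent (Polynomial.toLaurent f * LaurentPolynomial.T k)⁆ : Virasoro).2 • z := by
  conv_lhs => rw [eq_ofLaurent_add ⁅ofLaurent (Polynomial.toLaurent f * LaurentPolynomial.T j),
    ofLaurent (Polynomial.toLaurent f * LaurentPolynomial.T k)⁆]
  congr 1
  rw [toLaurent_lie, toLaurent_ofLaurent, toLaurent_ofLaurent, ← map_smul]
  congr 1
  simp only [euler_mul, euler_T, map_pow, LaurentPolynomial.T_add,
    LaurentPolynomial.smul_eq_C_mul, map_sub]
  ring

/-- A linear form vanishing on the brackets of elements of `Vir^f` vanishes on `z` and on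
`Vir^(f²)`. -/
theorem eq_zero_of_lie_eq_zero {f : ℂ[X]} (hf : f.coeff 0 ≠ 0) {ν : Virasoro →ₗ[ℂ] ℂ}
    (hν : ∀ x ∈ polySubalgebra f, ∀ y ∈ polySubalgebra f, ν ⁅x, y⁆ = 0) :
    ν z = 0 ∧ ∀ x ∈ polySubalgebra (f ^ 2), ν x = 0 := by
  have hF : ∀ j, ofLaurent (Polynomial.toLaurent f * LaurentPolynomial.T j) ∈ polySubalgebra f :=
    fun j => by
      rw [mem_polySubalgebra_iff_dvd, toLaurent_ofLaurent]
      exact dvd_mul_right _ _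
  have h1 := fun j k => hν _ (hF j) _ (hF k)
  -- The cocycle (j³ - j)/12 vanishes at j = 1 and equals 1/2 at j = 2. The first bracket therefore
  -- gives ν(f²) = 0, and the second then gives ν(z) = 0 because f(0) ≠ 0.
  have h2 := h1 1 (-1)
  have h3 := h1 2 (-2)
  rw [lie_ofLaurent_mul_T, lie_ofLaurent_snd] at h2 h3
  simp only [map_add, map_smul, smul_eq_mul, add_neg_cancel] at h2 h3
  set a := ν (ofLaurent (Polynomial.toLaurent (f ^ 2) * LaurentPolynomial.T 0)) with ha
  push_cast at h2 h3
  have ha0 : a = 0 := by linear_combination -h2 / 2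
  have hz : ν z = 0 := by
    rw [ha0] at h3
    have : f.coeff 0 * f.coeff 0 * ν z = 0 := by linear_combination 2 * h3
    simpa [hf] using this
  refine ⟨hz, ?_⟩
  have h4 : ∀ m, ν (ofLaurent (Polynomial.toLaurent (f ^ 2) * LaurentPolynomial.T m)) = 0 := by
    intro m
    by_cases hm : m = 0
    · rw [hm]; exact ha0
    · have h5 := h1 0 m
      rw [lie_ofLaurent_mul_T, map_add, map_smul, map_smul, hz] at h5
      simpa [hm] using h5
  intro x hx
  obtain ⟨s, hs⟩ := mem_polySubalgebra_iff_dvd.mp hx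
  rw [eq_ofLaurent_add x, map_add, map_smul, hz, smul_zero, add_zero, hs]
  induction s using laurent_induction generalizing x with
  | hadd p q hp hq =>
    rw [mul_add, map_add, map_add]
    have hmem : ∀ p, ofLaurent (Polynomial.toLaurent (f ^ 2) * p) ∈ polySubalgebra (f ^ 2) :=
      fun p => by
        rw [mem_polySubalgebra_iff_dvd, toLaurent_ofLaurent]
        exact dvd_mul_right _ _
    rw [hp _ (hmem p) (toLaurent_ofLaurent _), hq _ (hmem q) (toLaurent_ofLaurent _), add_zero]
  | hT n c => rw [mul_smul_comm, map_smul, map_smul, h4, smul_zero]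

theorem character_eq_zero {f : ℂ[X]} (hf : f.coeff 0 ≠ 0)
    (μ : LieAlgebra.LieCharacter ℂ (polySubalgebra f)) {x : Virasoro}
    (hx : x ∈ polySubalgebra (f ^ 2)) (hx' : x ∈ polySubalgebra f) : μ ⟨x, hx'⟩ = 0 := by
  obtain ⟨ν, hν⟩ := LinearMap.exists_extend (p := (polySubalgebra f).toSubmodule)
    (μ : polySubalgebra f →ₗ[ℂ] ℂ)
  have hν' : ∀ x (hx : x ∈ polySubalgebra f), ν x = μ ⟨x, hx⟩ := fun x hx =>
    DFunLike.congr_fun hν ⟨x, hx⟩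
  rw [← hν']
  refine (eq_zero_of_lie_eq_zero hf ?_).2 x hx
  intro x hx y hy
  rw [hν' _ ((polySubalgebra f).lie_mem hx hy)]
  exact LieAlgebra.lieCharacter_apply_lie μ ⟨x, hx⟩ ⟨y, hy⟩

/-- Every vector of `V^(f^n)_μ`, where `f = t - a`, is annihilated by some `Vir^(f^N)`. -/
theorem exists_annihilator (a : ℂˣ) (n : ℕ) (μ : LieAlgebra.LieCharacter ℂ
      (polySubalgebra ((Polynomial.X - Polynomial.C (a : ℂ)) ^ n)))
    (v : polyModule ((Polynomial.X - Polynomial.C (a : ℂ)) ^ n) μ) :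
    ∃ N : ℕ, ∀ x ∈ polySubalgebra ((Polynomial.X - Polynomial.C (a : ℂ)) ^ N), ⁅x, v⁆ = 0 := by
  let S : Submodule ℂ (polyModule ((Polynomial.X - Polynomial.C (a : ℂ)) ^ n) μ) :=
    { carrier := {v | ∃ N : ℕ, ∀ x ∈ polySubalgebra ((Polynomial.X - Polynomial.C (a : ℂ)) ^ N), ⁅x, v⁆ = 0}
      zero_mem' := ⟨0, fun x _ => lie_zero x⟩
      add_mem' := by
        rintro v w ⟨N, hN⟩ ⟨M, hM⟩
        refine ⟨N + M, fun x hx => ?_⟩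
        rw [lie_add, hN x (polySubalgebra_mono (pow_dvd_pow _ (by omega)) hx),
          hM x (polySubalgebra_mono (pow_dvd_pow _ (by omega)) hx), add_zero]
      smul_mem' := by
        rintro c v ⟨N, hN⟩
        exact ⟨N, fun x hx => by rw [lie_smul, hN x hx, smul_zero]⟩ }
  refine InducedModule.induction (S := S) ?_ ?_ v
  -- Elements of Vir^(f^(2n)) act on the generator through μ, which vanishes on them.
  · refine ⟨n * 2, fun x hx => ?_⟩
    rw [pow_mul] at hx
    have hx' : x ∈ polySubalgebra ((Polynomial.X - Polynomial.C (a : ℂ)) ^ n) := polySubalgebra_mono (dvd_pow_self _ two_ne_zero) hx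
    rw [InducedModule.lie_gen hx', character_eq_zero ?_ μ hx, zero_smul]
    simp [Polynomial.coeff_zero_eq_eval_zero]
  · rintro x v ⟨N, hN⟩
    refine ⟨N + 1, fun y hy => ?_⟩
    rw [leibniz_lie, hN y (polySubalgebra_mono (pow_dvd_pow _ (by omega)) hy), lie_zero, add_zero]
    exact hN _ (lie_mem_polySubalgebra_pow (k := 0) le_rfl hy (mem_polySubalgebra_pow_zero _ x))

end Virasoro

/-! ### Local parts of the action -/

namespace Virasoro

/-- The polynomial vanishing to first order at a nonzero point (`some a`) or at zero (`none`). -/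
def localParam : Option ℂˣ → ℂ[X]
  | none => Polynomial.X
  | some a => Polynomial.X - Polynomial.C (a : ℂ)

/-- The elements of the Virasoro algebra vanishing to order `N` at a nonzero point (`some a`) or
at zero (`none`). -/
def vanishing : Option ℂˣ → ℕ → Submodule ℂ Virasoro
  | none, N => geSpan N
  | some a, N => (polySubalgebra ((Polynomial.X - Polynomial.C (a : ℂ)) ^ N)).toSubmodule

theorem vanishing_antitone (c : Option ℂˣ) : Antitone (vanishing c) := by
  intro N M h
  cases c with
  | none =>
    refine Submodule.span_mono (Set.union_subset_union_right _ ?_)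
    rintro x ⟨j, hj, rfl⟩
    exact ⟨j, by omega, rfl⟩
  | some a => exact polySubalgebra_mono (pow_dvd_pow _ h)

theorem ofLaurent_T_mul_mem_geSpan (L : ℕ) (r : ℂ[X]) :
    ofLaurent (LaurentPolynomial.T L * Polynomial.toLaurent r) ∈ geSpan L := by
  induction r using Polynomial.induction_on' with
  | add p q hp hq => rw [map_add, mul_add, map_add]; exact Submodule.add_mem _ hp hq
  | monomial n a =>
    rw [Polynomial.toLaurent_C_mul_T, mul_left_comm, ← LaurentPolynomial.T_add,
      ← LaurentPolynomial.smul_eq_C_mul, map_smul, ofLaurent_T]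
    exact Submodule.smul_mem _ _ (Submodule.subset_span (Or.inr ⟨_, by omega, rfl⟩))

/-- K compensates a possible pole of p at 0. It is needed only for `none`, but one K serves all
points. -/
theorem exists_ofLaurent_mul_mem_vanishing (p : ℂ[T;T⁻¹]) :
    ∃ K : ℕ, ∀ c N r, localParam c ^ (N + K) ∣ r →
      ofLaurent (p * Polynomial.toLaurent r) ∈ vanishing c N := by
  obtain ⟨K, q, hq⟩ := p.exists_T_pow
  refine ⟨K, fun c N r hr => ?_⟩
  cases c with
  | none =>
    obtain ⟨s, rfl⟩ := hr
    have h1 : p * Polynomial.toLaurent (localParam none ^ (N + K) * s) =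
        LaurentPolynomial.T N * Polynomial.toLaurent (q * s) := by
      rw [localParam, map_mul, map_mul, Polynomial.toLaurent_X_pow, hq, Nat.cast_add,
        LaurentPolynomial.T_add]
      ring
    rw [h1]
    exact ofLaurent_T_mul_mem_geSpan N _
  | some a =>
    refine mem_polySubalgebra_iff_dvd.mpr ?_
    rw [toLaurent_ofLaurent]
    exact dvd_mul_of_dvd_right (map_dvd _ ((pow_dvd_pow _ (by omega)).trans hr)) _

theorem z_mem_vanishing (c : Option ℂˣ) (N : ℕ) : z ∈ vanishing c N := by
  cases c with
  | none => exact Submodule.subset_span (Or.inl rfl)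
  | some a => exact z_mem_polySubalgebra _

theorem isCoprime_localParam {c d : Option ℂˣ} (h : c ≠ d) :
    IsCoprime (localParam c) (localParam d) := by
  have key : ∀ a b : ℂ, a ≠ b →
      IsCoprime (Polynomial.X - Polynomial.C a) (Polynomial.X - Polynomial.C b) :=
    fun a b h => Polynomial.isCoprime_X_sub_C_of_isUnit_sub (sub_ne_zero.mpr h).isUnit
  cases c with
  | none => cases d with
    | none => exact absurd rfl h
    | some b => simpa [localParam] using key 0 b b.ne_zero.symm
  | some a => cases d with
    | none => simpa [localParam] using key a 0 a.ne_zero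
    | some b => exact key a b fun hab => h (congrArg some (Units.ext hab))

/-- Simultaneous approximation: an element of the Virasoro algebra close to `x` at one point and
close to `0` at finitely many others. -/
theorem exists_approximation (c : Option ℂˣ) (S : Finset (Option ℂˣ)) (N : ℕ) (x : Virasoro) :
    ∃ y, y - x ∈ vanishing c N ∧ ∀ d ∈ S, d ≠ c → y ∈ vanishing d N := by
  obtain ⟨K, hK⟩ := exists_ofLaurent_mul_mem_vanishing (toLaurent x)
  have hcop : IsCoprime (localParam c ^ (N + K))
      (∏ d ∈ S.erase c, localParam d ^ (N + K)) := by
    refine IsCoprime.prod_right fun d hd => ?_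
    exact (isCoprime_localParam (Finset.ne_of_mem_erase hd).symm).pow
  obtain ⟨u, v, huv⟩ := hcop
  set Q := ∏ d ∈ S.erase c, localParam d ^ (N + K) with hQ
  -- By the Bézout relation, v Q is 1 modulo a high power of the parameter at c and divisible by
  -- high powers of the parameters at the other points. The central part of x can be dropped, as z
  -- lies in every `vanishing c N`.
  refine ⟨ofLaurent (toLaurent x * Polynomial.toLaurent (v * Q)), ?_, ?_⟩
  · have h1 : ofLaurent (toLaurent x * Polynomial.toLaurent (v * Q)) - x =
        ofLaurent (toLaurent x * Polynomial.toLaurent (-u * localParam c ^ (N + K))) -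
          x.2 • z := by
      have h2 : v * Q = 1 + -u * localParam c ^ (N + K) := by linear_combination huv
      rw [h2, map_add, map_one, mul_add, mul_one, map_add,
        eq_sub_of_add_eq (eq_ofLaurent_add x).symm]
      abel
    rw [h1]
    exact Submodule.sub_mem _ (hK _ _ _ (Dvd.intro_left _ rfl))
      (Submodule.smul_mem _ _ (z_mem_vanishing c N))
  · intro d hd hdc
    refine hK _ _ _ (dvd_mul_of_dvd_right ?_ _)
    exact Finset.dvd_prod_of_mem _ (Finset.mem_erase.mpr ⟨hdc, hd⟩)

section LocalPart

variable {M M' : Type*} [AddCommGroup M] [LieRingModule Virasoro M] [AddCommGroup M']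
  [LieRingModule Virasoro M']

/-- `w'` is the image of `w` under all elements that approximate `x` at the point `c` and vanish
to high order at finitely many other points. -/
def IsLocalPart (c : Option ℂˣ) (x : Virasoro) (w w' : M) : Prop :=
  ∃ (S : Finset (Option ℂˣ)) (N : ℕ), ∀ y, y - x ∈ vanishing c N →
    (∀ d ∈ S, d ≠ c → y ∈ vanishing d N) → ⁅y, w⁆ = w'

theorem IsLocalPart.unique {c : Option ℂˣ} {x : Virasoro} {w w₁ w₂ : M}
    (h₁ : IsLocalPart c x w w₁) (h₂ : IsLocalPart c x w w₂) : w₁ = w₂ := by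
  obtain ⟨S₁, N₁, h₁⟩ := h₁
  obtain ⟨S₂, N₂, h₂⟩ := h₂
  classical
  obtain ⟨y, hy, hy'⟩ := exists_approximation c (S₁ ∪ S₂) (max N₁ N₂) x
  rw [← h₁ y (vanishing_antitone c (le_max_left _ _) hy) fun d hd hdc =>
      vanishing_antitone d (le_max_left _ _) (hy' d (Finset.mem_union_left _ hd) hdc),
    ← h₂ y (vanishing_antitone c (le_max_right _ _) hy) fun d hd hdc =>
      vanishing_antitone d (le_max_right _ _) (hy' d (Finset.mem_union_right _ hd) hdc)]

theorem IsLocalPart.map {c : Option ℂˣ} {x : Virasoro} {w w' : M} (h : IsLocalPart c x w w')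
    {φ : M → M'} (hφ : ∀ (x : Virasoro) w, φ ⁅x, w⁆ = ⁅x, φ w⁆) :
    IsLocalPart c x (φ w) (φ w') := by
  obtain ⟨S, N, h⟩ := h
  exact ⟨S, N, fun y hy hy' => by rw [← hφ, h y hy hy']⟩

end LocalPart

/-- A decomposition of the action of the Virasoro algebra on `M` into a sum of linear maps
`slot s`, each of which is locally concentrated at the point `pt s`, for distinct points. -/
structure LocalDecomposition (M : Type*) [AddCommGroup M] [Module ℂ M] [LieRingModule Virasoro M]
    (ι : Type*) [Fintype ι] where
  slot : ι → Virasoro →ₗ[ℂ] Module.End ℂ M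
  pt : ι → Option ℂˣ
  pt_injective : Function.Injective pt
  lie_eq_sum : ∀ (x : Virasoro) w, ⁅x, w⁆ = ∑ s, slot s x w
  exists_vanishing : ∀ s w, ∃ N, ∀ x ∈ vanishing (pt s) N, slot s x w = 0

namespace LocalDecomposition

variable {M M' : Type*} [AddCommGroup M] [Module ℂ M] [LieRingModule Virasoro M]
  [AddCommGroup M'] [Module ℂ M'] [LieRingModule Virasoro M'] {ι ι' : Type*} [Fintype ι]
  [Fintype ι'] (D : LocalDecomposition M ι) (D' : LocalDecomposition M' ι')

include D in
theorem exists_uniform (w : M) : ∃ N, ∀ s, ∀ x ∈ vanishing (D.pt s) N, D.slot s x w = 0 := by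
  choose N hN using fun s => D.exists_vanishing s w
  refine ⟨Finset.univ.sup N, fun s x hx => hN s x ?_⟩
  exact vanishing_antitone _ (Finset.le_sup (f := N) (Finset.mem_univ s)) hx

/-- An element close to x at `pt s` and vanishing to high order at the other points acts through
slot s alone. With `IsLocalPart.unique`, the slots are thus determined by the module structure. -/
theorem isLocalPart_slot (s : ι) (x : Virasoro) (w : M) :
    IsLocalPart (D.pt s) x w (D.slot s x w) := by
  classical
  obtain ⟨N, hN⟩ := D.exists_uniform w
  refine ⟨Finset.univ.image D.pt, N, fun y hy hy' => ?_⟩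
  rw [D.lie_eq_sum, Finset.sum_eq_single s]
  · have := hN s _ hy
    rwa [map_sub, LinearMap.sub_apply, sub_eq_zero] at this
  · intro s' _ hs'
    exact hN s' _ (hy' _ (Finset.mem_image_of_mem _ (Finset.mem_univ _))
      fun h => hs' (D.pt_injective h))
  · simp

theorem isLocalPart_zero {c : Option ℂˣ} (hc : ∀ s, D.pt s ≠ c) (x : Virasoro) (w : M) :
    IsLocalPart c x w 0 := by
  classical
  obtain ⟨N, hN⟩ := D.exists_uniform w
  refine ⟨Finset.univ.image D.pt, N, fun y _ hy' => ?_⟩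
  rw [D.lie_eq_sum]
  exact Finset.sum_eq_zero fun s _ =>
    hN s _ (hy' _ (Finset.mem_image_of_mem _ (Finset.mem_univ _)) (hc s))

/-- Local parts are defined by the Vir-action alone, so equivariant maps preserve them, and both
sides are the local part of the action on φ w at the same point. -/
theorem map_slot {φ : M → M'} (hφ : ∀ (x : Virasoro) w, φ ⁅x, w⁆ = ⁅x, φ w⁆) {s : ι} {s' : ι'}
    (h : D.pt s = D'.pt s') (x : Virasoro) (w : M) :
    φ (D.slot s x w) = D'.slot s' x (φ w) := by
  refine ((D.isLocalPart_slot s x w).map hφ).unique ?_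
  rw [h]
  exact D'.isLocalPart_slot s' x (φ w)

/-- At a point absent from the target, elements vanishing at all target points compute the local
part, which is therefore 0. -/
theorem map_slot_eq_zero {φ : M → M'} (hφ : ∀ (x : Virasoro) w, φ ⁅x, w⁆ = ⁅x, φ w⁆) {s : ι}
    (h : ∀ s', D'.pt s' ≠ D.pt s) (x : Virasoro) (w : M) : φ (D.slot s x w) = 0 :=
  ((D.isLocalPart_slot s x w).map hφ).unique (D'.isLocalPart_zero h x (φ w))

end LocalDecomposition

end Virasoro

/-! ### Spectral subspaces -/

/-- The vectors annihilated by a nonzero polynomial in `A` all of whose roots lie in `S`. -/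
def Module.End.spectralSubmodule {K M : Type*} [Field K] [AddCommGroup M] [Module K M]
    (A : Module.End K M) (S : Set K) : Submodule K M where
  carrier := {v | ∃ P : K[X], P ≠ 0 ∧ (∀ r, P.IsRoot r → r ∈ S) ∧ Polynomial.aeval A P v = 0}
  zero_mem' := ⟨1, one_ne_zero, fun r hr => absurd hr (by simp), map_zero _⟩
  add_mem' := by
    rintro v w ⟨P, hP, hPS, hPv⟩ ⟨Q, hQ, hQS, hQw⟩
    refine ⟨P * Q, mul_ne_zero hP hQ, fun r hr => ?_, ?_⟩
    · rcases Polynomial.root_mul.mp hr with h | h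
      exacts [hPS r h, hQS r h]
    · rw [map_add, map_mul, Module.End.mul_apply, Module.End.mul_apply, hQw, map_zero, add_zero,
        ← Module.End.mul_apply, ← map_mul, mul_comm, map_mul, Module.End.mul_apply, hPv, map_zero]
  smul_mem' := by
    rintro c v ⟨P, hP, hPS, hPv⟩
    exact ⟨P, hP, hPS, by rw [map_smul, hPv, smul_zero]⟩

section Spectral

variable {K M N : Type*} [Field K] [AddCommGroup M] [Module K M] [AddCommGroup N] [Module K N]
  {A : Module.End K M} {B : Module.End K N} {S : Set K}

theorem Module.End.spectralSubmodule_mono {S' : Set K} (h : S ⊆ S') :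
    A.spectralSubmodule S ≤ A.spectralSubmodule S' := by
  rintro v ⟨P, hP, hPS, hPv⟩
  exact ⟨P, hP, fun r hr => h (hPS r hr), hPv⟩

theorem Module.End.map_mem_spectralSubmodule {φ : M →ₗ[K] N} (h : ∀ v, φ (A v) = B (φ v)) {v : M}
    (hv : v ∈ A.spectralSubmodule S) : φ v ∈ B.spectralSubmodule S := by
  obtain ⟨P, hP, hPS, hPv⟩ := hv
  exact ⟨P, hP, hPS, by rw [← LinearMap.map_aeval_apply h, hPv, map_zero]⟩

theorem Module.End.eigenvalue_mem_of_mem_spectralSubmodule {v : M}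
    (hv : v ∈ A.spectralSubmodule S) (hv0 : v ≠ 0) {c : K} (hc : A v = c • v) : c ∈ S := by
  obtain ⟨P, -, hPS, hPv⟩ := hv
  have := Module.End.aeval_apply_of_hasEigenvector (p := P)
    (Module.End.hasEigenvector_iff.mpr ⟨Module.End.mem_eigenspace_iff.mpr hc, hv0⟩)
  rw [hPv] at this
  exact hPS c ((smul_eq_zero.mp this.symm).resolve_right hv0)

end Spectral

namespace Virasoro

open Module.End (maxGenEigenspace spectralSubmodule)

/-- For `n ≥ 2` the elements of `Vir^(f^n)`, `f = t - a`, act on `V^(f^n)_μ` with the single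
generalized eigenvalue given by `μ`. -/
theorem polyModule_mem_maxGenEigenspace (a : ℂˣ) {n : ℕ} (hn : 2 ≤ n) (μ : LieAlgebra.LieCharacter ℂ
      (polySubalgebra ((Polynomial.X - Polynomial.C (a : ℂ)) ^ n)))
    (x : polySubalgebra ((Polynomial.X - Polynomial.C (a : ℂ)) ^ n))
    (v : polyModule ((Polynomial.X - Polynomial.C (a : ℂ)) ^ n) μ) :
    v ∈ maxGenEigenspace (LieModule.toEnd ℂ Virasoro
      (polyModule ((Polynomial.X - Polynomial.C (a : ℂ)) ^ n) μ) (x : Virasoro)) (μ x) := by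
  set A := LieModule.toEnd ℂ Virasoro
    (polyModule ((Polynomial.X - Polynomial.C (a : ℂ)) ^ n) μ) (x : Virasoro) with hA
  have back : ∀ v, (A - μ x • 1) v ∈ A.maxGenEigenspace (μ x) → v ∈ A.maxGenEigenspace (μ x) := by
    intro v hv
    obtain ⟨k, hk⟩ := (Module.End.mem_maxGenEigenspace _ _ _).mp hv
    exact (Module.End.mem_maxGenEigenspace _ _ _).mpr ⟨k + 1, by rw [pow_succ, Module.End.mul_apply, hk]⟩
  -- The outer induction is on the exponent k killing v. The inner one lowers the order of vanishing
  -- of y from N, where y v = 0, to 0. As n ≥ 2, [x, y] vanishes to higher order than is assumed of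
  -- y, so it is covered by the previous inner step.
  have key : ∀ (k : ℕ) v, ((A - μ x • 1 : Module.End ℂ _) ^ k) v = 0 → ∀ y : Virasoro,
      ⁅y, v⁆ ∈ A.maxGenEigenspace (μ x) := by
    intro k
    induction k with
    | zero =>
      intro v hv y
      have : v = 0 := by simpa using hv
      rw [this, lie_zero]
      exact Submodule.zero_mem _
    | succ k ih =>
      intro v hv y
      rw [pow_succ, Module.End.mul_apply] at hv
      have h1 := ih _ hv
      obtain ⟨N, hN⟩ := exists_annihilator a n μ v
      have h2 : ∀ j ≤ N, ∀ y ∈ polySubalgebra ((Polynomial.X - Polynomial.C (a : ℂ)) ^ (N - j)),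
          ⁅y, v⁆ ∈ A.maxGenEigenspace (μ x) := by
        intro j
        induction j with
        | zero =>
          intro _ y hy
          rw [hN y hy]
          exact Submodule.zero_mem _
        | succ j ihj =>
          intro hj y hy
          apply back
          have h3 : (A - μ x • 1) ⁅y, v⁆ = ⁅y, (A - μ x • 1) v⁆ + ⁅⁅(x : Virasoro), y⁆, v⁆ := by
            simp only [hA, LinearMap.sub_apply, LieModule.toEnd_apply_apply, LinearMap.smul_apply,
              Module.End.one_apply, lie_sub, lie_smul]
            rw [leibniz_lie]
            abel
          rw [h3]
          exact Submodule.add_mem _ (h1 y) (ihj (by omega) _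
            (lie_mem_polySubalgebra_pow (by omega) x.2 hy))
      refine h2 N le_rfl y ?_
      rw [Nat.sub_self]
      exact mem_polySubalgebra_pow_zero _ _
  refine InducedModule.induction (S := A.maxGenEigenspace (μ x)) ?_ ?_ v
  · refine (Module.End.mem_maxGenEigenspace _ _ _).mpr ⟨1, ?_⟩
    rw [pow_one, LinearMap.sub_apply, hA, LieModule.toEnd_apply_apply,
      InducedModule.lie_gen x.2, LinearMap.smul_apply, Module.End.one_apply, sub_self]
  · intro y v hv
    obtain ⟨k, hk⟩ := (Module.End.mem_maxGenEigenspace _ _ _).mp hv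
    exact key k v hk y

theorem mem_spectralSubmodule_of_two_le (a : ℂˣ) {n : ℕ} (hn : 2 ≤ n)
    (μ : LieAlgebra.LieCharacter ℂ
      (polySubalgebra ((Polynomial.X - Polynomial.C (a : ℂ)) ^ n)))
    (x : polySubalgebra ((Polynomial.X - Polynomial.C (a : ℂ)) ^ n))
    (v : polyModule ((Polynomial.X - Polynomial.C (a : ℂ)) ^ n) μ) :
    v ∈ spectralSubmodule (LieModule.toEnd ℂ Virasoro
      (polyModule ((Polynomial.X - Polynomial.C (a : ℂ)) ^ n) μ) (x : Virasoro)) {μ x} := by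
  obtain ⟨k, hk⟩ := (Module.End.mem_maxGenEigenspace _ _ _).mp
    (polyModule_mem_maxGenEigenspace a hn μ x v)
  refine ⟨(Polynomial.X - Polynomial.C (μ x)) ^ k, pow_ne_zero _ (Polynomial.X_sub_C_ne_zero _),
    fun r hr => ?_, ?_⟩
  · rw [Polynomial.IsRoot.def, Polynomial.eval_pow] at hr
    simpa [sub_eq_zero] using eq_zero_of_pow_eq_zero hr
  · rw [← hk]
    simp [Algebra.algebraMap_eq_smul_one]

/-- If `Vir^f` has codimension at most one, complemented by `e_0`, the eigenvalues of its elements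
on `V^f_μ` form arithmetic progressions starting from the value of `μ`. -/
theorem mem_spectralSubmodule_of_codim_one {f : ℂ[X]}
    (hf : ∀ y : Virasoro, ∃ c : ℂ, y - c • e 0 ∈ polySubalgebra f)
    (μ : LieAlgebra.LieCharacter ℂ (polySubalgebra f)) (x : polySubalgebra f) {c : ℂ}
    (hc : ⁅(x : Virasoro), e 0⁆ - c • e 0 ∈ polySubalgebra f) (v : polyModule f μ) :
    v ∈ spectralSubmodule (LieModule.toEnd ℂ Virasoro (polyModule f μ) (x : Virasoro))
      (Set.range fun d : ℕ => μ x + d * c) := by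
  set E := LieModule.toEnd ℂ Virasoro (polyModule f μ) (e 0) with hE
  set A := LieModule.toEnd ℂ Virasoro (polyModule f μ) (x : Virasoro) with hA
  -- F d is spanned by the e_0^j applied to the generator, j ≤ d. Since [x, e_0] is c e_0 modulo
  -- Vir^f, x acts on the successive quotient in degree d as the scalar μ(x) + d c.
  obtain ⟨F, hF0, hFs⟩ : ∃ F : ℕ → Submodule ℂ (polyModule f μ),
      F 0 = Submodule.span ℂ {InducedModule.gen (polySubalgebra f) μ} ∧
      ∀ d, F (d + 1) = F d ⊔ (F d).map E :=
    ⟨fun d => Nat.rec (Submodule.span ℂ {InducedModule.gen (polySubalgebra f) μ})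
      (fun _ G => G ⊔ G.map E) d, rfl, fun _ => rfl⟩
  have hmono : Monotone F := monotone_nat_of_le_succ fun d => by rw [hFs]; exact le_sup_left
  have hH : ∀ d, ∀ h ∈ polySubalgebra f, ∀ w ∈ F d, ⁅h, w⁆ ∈ F d := by
    intro d
    induction d with
    | zero =>
      intro h hh w hw
      rw [hF0, Submodule.mem_span_singleton] at hw ⊢
      obtain ⟨r, rfl⟩ := hw
      rw [lie_smul, InducedModule.lie_gen hh]
      exact ⟨r * μ ⟨h, hh⟩, by rw [mul_smul]⟩
    | succ d ih =>
      intro h hh w hw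
      rw [hFs] at hw ⊢
      obtain ⟨w₁, hw₁, _, ⟨w₂, hw₂, rfl⟩, rfl⟩ := Submodule.mem_sup.mp hw
      rw [lie_add]
      refine Submodule.add_mem _ (Submodule.mem_sup_left (ih h hh w₁ hw₁)) ?_
      obtain ⟨r, hr⟩ := hf ⁅h, e 0⁆
      have h1 : ⁅h, E w₂⁆ = E (⁅h, w₂⁆ + r • w₂) + ⁅⁅h, e 0⁆ - r • e 0, w₂⁆ := by
        simp only [hE, LieModule.toEnd_apply_apply, lie_add, lie_smul, sub_lie, smul_lie]
        rw [leibniz_lie]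
        abel
      rw [h1]
      exact Submodule.add_mem _ (Submodule.mem_sup_right (Submodule.mem_map_of_mem
        (Submodule.add_mem _ (ih h hh w₂ hw₂) (Submodule.smul_mem _ _ hw₂))))
        (Submodule.mem_sup_left (ih _ hr w₂ hw₂))
  have hspec : ∀ d, ∀ w ∈ F d, w ∈ A.spectralSubmodule (Set.range fun d : ℕ => μ x + d * c) := by
    have back : ∀ (d : ℕ) w, (A - (μ x + d * c) • 1) w ∈
        A.spectralSubmodule (Set.range fun d : ℕ => μ x + d * c) →
        w ∈ A.spectralSubmodule (Set.range fun d : ℕ => μ x + d * c) := by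
      rintro d w ⟨P, hP, hPS, hPw⟩
      refine ⟨P * (Polynomial.X - Polynomial.C (μ x + d * c)),
        mul_ne_zero hP (Polynomial.X_sub_C_ne_zero _), fun r hr => ?_, ?_⟩
      · rcases Polynomial.root_mul.mp hr with h | h
        · exact hPS r h
        · exact ⟨d, (Polynomial.root_X_sub_C.mp h)⟩
      · rw [map_mul, Module.End.mul_apply, map_sub, Polynomial.aeval_X, Polynomial.aeval_C,
          Algebra.algebraMap_eq_smul_one, hPw]
    have step0 : ∀ w ∈ F 0, (A - (μ x + (0 : ℕ) * c) • 1) w = 0 := by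
      intro w hw
      rw [hF0, Submodule.mem_span_singleton] at hw
      obtain ⟨r, rfl⟩ := hw
      rw [map_smul, LinearMap.sub_apply, hA, LieModule.toEnd_apply_apply,
        InducedModule.lie_gen x.2]
      simp
    -- Moving x past e_0 shifts the eigenvalue by c, up to an error in Vir^f, which preserves each F
    -- d.
    have comm : ∀ (d : ℕ) w, (A - (μ x + (d + 1 : ℕ) * c) • 1) (E w) =
        E ((A - (μ x + d * c) • 1) w) + ⁅⁅(x : Virasoro), e 0⁆ - c • e 0, w⁆ := by
      intro d w
      simp only [hA, hE, LinearMap.sub_apply, LieModule.toEnd_apply_apply, LinearMap.smul_apply,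
        Module.End.one_apply, lie_sub, lie_smul, sub_lie, smul_lie]
      rw [leibniz_lie]
      push_cast
      module
    have stable : ∀ (d : ℕ) (r : ℂ), ∀ w ∈ F d, (A - r • 1) w ∈ F d := fun d r w hw =>
      Submodule.sub_mem _ (hH d x x.2 w hw) (Submodule.smul_mem _ _ hw)
    have step : ∀ (d : ℕ), ∀ w ∈ F (d + 1), (A - (μ x + (d + 1 : ℕ) * c) • 1) w ∈ F d := by
      intro d
      induction d with
      | zero =>
        intro w hw
        rw [hFs] at hw
        obtain ⟨w₁, hw₁, _, ⟨w₂, hw₂, rfl⟩, rfl⟩ := Submodule.mem_sup.mp hw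
        rw [map_add, comm, step0 w₂ hw₂, map_zero,
          zero_add ⁅⁅(x : Virasoro), e 0⁆ - c • e 0, w₂⁆]
        exact Submodule.add_mem _ (stable _ _ _ hw₁) (hH _ _ hc _ hw₂)
      | succ d ih =>
        intro w hw
        rw [hFs] at hw
        obtain ⟨w₁, hw₁, _, ⟨w₂, hw₂, rfl⟩, rfl⟩ := Submodule.mem_sup.mp hw
        rw [map_add, comm]
        refine Submodule.add_mem _ (stable _ _ _ hw₁)
          (Submodule.add_mem _ ?_ (hH _ _ hc _ hw₂))
        rw [hFs]
        exact Submodule.mem_sup_right (Submodule.mem_map_of_mem (ih w₂ hw₂))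
    intro d
    induction d with
    | zero =>
      intro w hw
      refine back 0 w ?_
      rw [step0 w hw]
      exact Submodule.zero_mem _
    | succ d ih => exact fun w hw => back (d + 1) w (ih _ (step d w hw))
  have hdir : Directed (· ≤ ·) F := hmono.directed_le
  have hall : v ∈ ⨆ d, F d := by
    refine InducedModule.induction (S := ⨆ d, F d) ?_ ?_ v
    · refine Submodule.mem_iSup_of_mem 0 ?_
      rw [hF0]
      exact Submodule.mem_span_singleton_self _
    · intro y w hw
      obtain ⟨d, hd⟩ := (Submodule.mem_iSup_of_directed _ hdir).mp hw
      obtain ⟨r, hr⟩ := hf y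
      refine Submodule.mem_iSup_of_mem (d + 1) ?_
      have h1 : ⁅y, w⁆ = ⁅y - r • e 0, w⁆ + E (r • w) := by
        simp only [hE, LieModule.toEnd_apply_apply, sub_lie, smul_lie, lie_smul]
        abel
      rw [h1, hFs]
      exact Submodule.add_mem _ (Submodule.mem_sup_left (hH d _ hr w hd))
        (Submodule.mem_sup_right (Submodule.mem_map_of_mem (Submodule.smul_mem _ _ hd)))
  obtain ⟨d, hd⟩ := (Submodule.mem_iSup_of_directed _ hdir).mp hall
  exact hspec d v hd

theorem exists_sub_smul_e_zero_mem (a : ℂˣ) (y : Virasoro) :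
    ∃ c : ℂ, y - c • e 0 ∈ polySubalgebra ((Polynomial.X - Polynomial.C (a : ℂ)) ^ 1) := by
  obtain ⟨c, hc⟩ := exists_sub_smul_mem (g := 1) a
    (by rw [polySubalgebra_one]; trivial : y ∈ polySubalgebra 1)
  rw [one_mul, map_one, ← LaurentPolynomial.T_zero, ofLaurent_T] at hc
  exact ⟨c, by rwa [pow_one]⟩

end Virasoro

/-! ### Tensor products -/

section PiTensor

variable {K ι : Type*} [Field K] {V : ι → Type*} [∀ i, AddCommGroup (V i)]
  [∀ i, Module K (V i)]

theorem PiTensorProduct.tprod_ne_zero [Fintype ι] {v : ∀ i, V i} (hv : ∀ i, v i ≠ 0) :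
    PiTensorProduct.tprod K v ≠ 0 := by
  choose f hf using fun i => Module.Projective.exists_dual_eq_one K (hv i)
  intro h
  have := congrArg (PiTensorProduct.lift
    ((MultilinearMap.mkPiAlgebra K ι K).compLinearMap f)) h
  simp [hf] at this

variable {X : Type*} [AddCommGroup X] [Module K X]

theorem TensorProduct.exists_dual_rTensor_ne_zero {T : Type*} [AddCommGroup T] [Module K T]
    {w : T ⊗[K] X} (hw : w ≠ 0) :
    ∃ f : Module.Dual K T, TensorProduct.lid K X (LinearMap.rTensor X f w) ≠ 0 := by
  classical
  by_contra! h
  let b := Module.Basis.ofVectorSpace K T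
  apply hw
  apply (TensorProduct.equivFinsuppOfBasisLeft b).injective
  rw [map_zero]
  ext i
  rw [Finsupp.zero_apply, ← h (b.coord i), TensorProduct.equivFinsuppOfBasisLeft_apply]

theorem TensorProduct.tmul_ne_zero_of_ne_zero {T : Type*} [AddCommGroup T] [Module K T] {t : T}
    {x : X} (ht : t ≠ 0) (hx : x ≠ 0) : t ⊗ₜ[K] x ≠ 0 := by
  obtain ⟨f, hf⟩ := Module.Projective.exists_dual_eq_one K ht
  intro h
  have := congrArg (fun w => TensorProduct.lid K X (LinearMap.rTensor X f w)) h
  simp [hf, hx] at this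

theorem mem_of_tprod_tmul_mem {S : Submodule K ((⨂[K] i, V i) ⊗[K] X)}
    (hS : ∀ v x, PiTensorProduct.tprod K v ⊗ₜ[K] x ∈ S) (w : (⨂[K] i, V i) ⊗[K] X) : w ∈ S := by
  induction w using TensorProduct.induction_on with
  | zero => exact S.zero_mem
  | add a b ha hb => exact S.add_mem ha hb
  | tmul t x =>
    have ht : t ∈ S.comap ((TensorProduct.mk K (⨂[K] i, V i) X).flip x) := by
      have : t ∈ Submodule.span K (Set.range (PiTensorProduct.tprod K (s := V))) := by
        rw [PiTensorProduct.span_tprod_eq_top]; trivial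
      refine Submodule.span_le.mpr ?_ this
      rintro _ ⟨v, rfl⟩
      exact hS v x
    exact ht

end PiTensor

section Slots

variable {K L ι : Type*} [Field K] [LieRing L] [LieAlgebra K L] [DecidableEq ι]
  (V : ι → Type*) [∀ i, AddCommGroup (V i)] [∀ i, Module K (V i)] [∀ i, LieRingModule L (V i)]
  [∀ i, LieModule K L (V i)] (X : Type*) [AddCommGroup X] [Module K X] [LieRingModule L X]
  [LieModule K L X]

/-- The action of a Lie algebra on one of the factors of `(⨂ i, V i) ⊗ X`. -/
def tensorSlot : Option ι → L →ₗ[K] Module.End K ((⨂[K] i, V i) ⊗[K] X)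
  | none => LinearMap.lTensorHom _ ∘ₗ (LieModule.toEnd K L X : L →ₗ[K] Module.End K X)
  | some i => LinearMap.rTensorHom X ∘ₗ
      { toFun := fun x => lieFactor K V x i
        map_add' := fun x y => lieFactor_add K V x y i
        map_smul' := fun c x => lieFactor_smul K V c x i }

/-- The inclusion of a factor into `(⨂ i, V i) ⊗ X`, the other components being fixed. -/
def tensorInsert (v : ∀ i, V i) (x : X) (i : ι) : V i →ₗ[K] (⨂[K] i, V i) ⊗[K] X :=
  (TensorProduct.mk K (⨂[K] i, V i) X).flip x ∘ₗ (PiTensorProduct.tprod K).toLinearMap v i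

variable {V X}

theorem tensorSlot_none_tmul (y : L) (t : ⨂[K] i, V i) (x : X) :
    tensorSlot (K := K) V X none y (t ⊗ₜ x) = t ⊗ₜ ⁅y, x⁆ := rfl

theorem tensorSlot_some_tmul (y : L) (i : ι) (t : ⨂[K] i, V i) (x : X) :
    tensorSlot (K := K) V X (some i) y (t ⊗ₜ x) = (lieFactor K V y i t) ⊗ₜ x := rfl

theorem tensorInsert_apply (v : ∀ i, V i) (x : X) (i : ι) (u : V i) :
    tensorInsert (K := K) V X v x i u =
      PiTensorProduct.tprod K (Function.update v i u) ⊗ₜ x := rfl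

theorem tensorInsert_lie (v : ∀ i, V i) (x : X) (i : ι) (y : L) (u : V i) :
    tensorInsert (K := K) V X v x i ⁅y, u⁆ =
      tensorSlot V X (some i) y (tensorInsert V X v x i u) := by
  rw [tensorInsert_apply, tensorInsert_apply, tensorSlot_some_tmul, lieFactor_tprod]
  simp

theorem tensorInsert_self (v : ∀ i, V i) (x : X) (i : ι) :
    tensorInsert (K := K) V X v x i (v i) = PiTensorProduct.tprod K v ⊗ₜ x := by
  rw [tensorInsert_apply, Function.update_eq_self]

theorem tensorInsert_ne_zero [Fintype ι] {v : ∀ i, V i} (hv : ∀ i, v i ≠ 0) {x : X} (hx : x ≠ 0)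
    (i : ι) {u : V i} (hu : u ≠ 0) : tensorInsert (K := K) V X v x i u ≠ 0 := by
  refine TensorProduct.tmul_ne_zero_of_ne_zero (PiTensorProduct.tprod_ne_zero fun j => ?_) hx
  by_cases h : j = i
  · subst h; simpa using hu
  · simpa [h] using hv j

theorem lie_eq_sum_tensorSlot [Fintype ι] (y : L) (w : (⨂[K] i, V i) ⊗[K] X) :
    ⁅y, w⁆ = ∑ s, tensorSlot (K := K) V X s y w := by
  induction w using TensorProduct.induction_on with
  | zero => simp
  | add a b ha hb => simp only [lie_add, map_add, Finset.sum_add_distrib, ha, hb]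
  | tmul t x =>
    rw [TensorProduct.LieModule.lie_tmul_right, Fintype.sum_option, tensorSlot_none_tmul, add_comm]
    congr 1
    simp only [tensorSlot_some_tmul]
    rw [← TensorProduct.sum_tmul]
    congr 1
    exact LinearMap.sum_apply _ _ _

/-- Pure tensors span, and each is the image of its i-th component under an insertion intertwining y
with its slot action. -/
theorem mem_spectralSubmodule_tensorSlot [Fintype ι] {i : ι} {y : L} {S : Set K}
    (h : ∀ u : V i, u ∈ Module.End.spectralSubmodule (LieModule.toEnd K L (V i) y) S)
    (w : (⨂[K] i, V i) ⊗[K] X) :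
    w ∈ Module.End.spectralSubmodule (tensorSlot V X (some i) y) S := by
  refine mem_of_tprod_tmul_mem (fun v x => ?_) w
  rw [← tensorInsert_self v x i]
  exact Module.End.map_mem_spectralSubmodule (fun u => tensorInsert_lie v x i y u) (h (v i))

end Slots

/-! ### Tensor products of modules over the Virasoro algebra -/

namespace Virasoro

section Decomposition

variable {M : Type*} [AddCommGroup M] [Module ℂ M]

/-- The vectors annihilated by all elements vanishing to high order at `c`. -/
def annihilatedSubmodule (c : Option ℂˣ) (A : Virasoro →ₗ[ℂ] Module.End ℂ M) :
    Submodule ℂ M where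
  carrier := {w | ∃ N, ∀ x ∈ vanishing c N, A x w = 0}
  zero_mem' := ⟨0, fun x _ => map_zero _⟩
  add_mem' := by
    rintro v w ⟨N, hN⟩ ⟨N', hN'⟩
    refine ⟨max N N', fun x hx => ?_⟩
    rw [map_add, hN x (vanishing_antitone c (le_max_left _ _) hx),
      hN' x (vanishing_antitone c (le_max_right _ _) hx), add_zero]
  smul_mem' := by
    rintro r v ⟨N, hN⟩
    exact ⟨N, fun x hx => by rw [map_smul, hN x hx, smul_zero]⟩

variable {ι : Type*} [Fintype ι] [DecidableEq ι] {lam : ι → ℂˣ} (hlam : Function.Injective lam)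
  {n : ι → ℕ} (μ : ∀ i, LieAlgebra.LieCharacter ℂ
    (polySubalgebra ((Polynomial.X - Polynomial.C (lam i : ℂ)) ^ n i)))
  {V : Type*} [AddCommGroup V] [Module ℂ V] [LieRingModule Virasoro V] [LieModule ℂ Virasoro V]
  (hV : IsLocallyAnnihilated V)

/-- The factors of a tensor product of modules induced at distinct points and of a locally
annihilated module form a local decomposition. -/
def tensorDecomposition : LocalDecomposition
    ((⨂[ℂ] i, polyModule ((Polynomial.X - Polynomial.C (lam i : ℂ)) ^ n i) (μ i)) ⊗[ℂ] V)
    (Option ι) where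
  slot := tensorSlot _ V
  pt := Option.map lam
  pt_injective := Option.map_injective hlam
  lie_eq_sum := lie_eq_sum_tensorSlot
  exists_vanishing s := by
    refine mem_of_tprod_tmul_mem (S := annihilatedSubmodule (Option.map lam s)
      (tensorSlot _ V s)) fun v u => ?_
    cases s with
    | none =>
      obtain ⟨N, hN⟩ := hV u
      refine ⟨N, fun x hx => ?_⟩
      rw [tensorSlot_none_tmul, hN x hx, TensorProduct.tmul_zero]
    | some i =>
      obtain ⟨N, hN⟩ := exists_annihilator (lam i) (n i) (μ i) (v i)
      refine ⟨N, fun x hx => ?_⟩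
      rw [← tensorInsert_self v u i, ← tensorInsert_lie, hN x hx, map_zero]

end Decomposition

end Virasoro

/-! ### Isomorphisms between tensor products -/

namespace Virasoro

/-- The codimension-one and the higher codimension case together: the eigenvalues of an element
of `Vir^(f^n)`, `f = t - a`, on `V^(f^n)_μ`. -/
theorem exists_spectral_progression (a : ℂˣ) {n : ℕ} (hn : 1 ≤ n) {x : Virasoro}
    (hx : x ∈ polySubalgebra ((Polynomial.X - Polynomial.C (a : ℂ)) ^ n)) :
    ∃ c : ℂ, ∀ (μ : LieAlgebra.LieCharacter ℂ
      (polySubalgebra ((Polynomial.X - Polynomial.C (a : ℂ)) ^ n)))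
      (v : polyModule ((Polynomial.X - Polynomial.C (a : ℂ)) ^ n) μ),
      v ∈ Module.End.spectralSubmodule (LieModule.toEnd ℂ Virasoro
        (polyModule ((Polynomial.X - Polynomial.C (a : ℂ)) ^ n) μ) x)
        (Set.range fun d : ℕ => μ ⟨x, hx⟩ + d * c) := by
  obtain rfl | hn := hn.eq_or_lt
  · obtain ⟨c, hc⟩ := exists_sub_smul_e_zero_mem a ⁅x, e 0⁆
    exact ⟨c, fun μ v => mem_spectralSubmodule_of_codim_one (exists_sub_smul_e_zero_mem a) μ
      ⟨x, hx⟩ hc v⟩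
  · refine ⟨0, fun μ v => Module.End.spectralSubmodule_mono ?_
      (mem_spectralSubmodule_of_two_le a hn μ ⟨x, hx⟩ v)⟩
    rintro _ rfl
    exact ⟨0, by simp⟩

theorem rootProd_replicate (n : ℕ) (a : ℂˣ) :
    rootProd (Multiset.replicate n a) = (Polynomial.X - Polynomial.C (a : ℂ)) ^ n := by
  simp [rootProd]

/-- One of the n - m surplus factors t - a supplies the step in which the element (t - a)^m is
adjoined freely. For m = 0 this element is e_0. -/
theorem aeval_pow_gen_ne_zero (a : ℂˣ) {n m : ℕ} (h : m < n) (μ : LieAlgebra.LieCharacter ℂ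
      (polySubalgebra ((Polynomial.X - Polynomial.C (a : ℂ)) ^ n))) {p : ℂ[X]} (hp : p ≠ 0) :
    Polynomial.aeval (LieModule.toEnd ℂ Virasoro
      (polyModule ((Polynomial.X - Polynomial.C (a : ℂ)) ^ n) μ)
      (ofLaurent (Polynomial.toLaurent ((Polynomial.X - Polynomial.C (a : ℂ)) ^ m)))) p
        (InducedModule.gen _ μ) ≠ 0 := by
  refine aeval_gen_ne_zero (pow_ne_zero _ (Polynomial.X_sub_C_ne_zero _)) a
    (Multiset.replicate (n - m - 1) a) (Multiset.replicate m a) (rootProd_replicate m a).symm ?_ μ hp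
  rw [rootProd_replicate, ← pow_succ, ← pow_add]
  congr 1
  omega

theorem gen_ne_zero (a : ℂˣ) {n : ℕ} (hn : 1 ≤ n) (μ : LieAlgebra.LieCharacter ℂ
      (polySubalgebra ((Polynomial.X - Polynomial.C (a : ℂ)) ^ n))) :
    InducedModule.gen _ μ ≠ 0 := by
  have := aeval_pow_gen_ne_zero a hn μ (one_ne_zero (α := ℂ[X]))
  simpa using this

theorem lie_e_zero_gen_ne_zero (a : ℂˣ) {n : ℕ} (hn : 1 ≤ n) (μ : LieAlgebra.LieCharacter ℂ
      (polySubalgebra ((Polynomial.X - Polynomial.C (a : ℂ)) ^ n))) :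
    ⁅e 0, InducedModule.gen _ μ⁆ ≠ 0 := by
  have := aeval_pow_gen_ne_zero a hn μ (Polynomial.X_ne_zero (R := ℂ))
  rwa [Polynomial.aeval_X, LieModule.toEnd_apply_apply, pow_zero, map_one,
    ← LaurentPolynomial.T_zero, ofLaurent_T] at this

section Isomorphism

variable {ι κ : Type*} [Fintype ι] [DecidableEq ι] [Fintype κ] [DecidableEq κ]
  {lam : ι → ℂˣ} (hlam : Function.Injective lam) {n : ι → ℕ} (hn : ∀ i, 1 ≤ n i)
  {μ : ∀ i, LieAlgebra.LieCharacter ℂ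
    (polySubalgebra ((Polynomial.X - Polynomial.C (lam i : ℂ)) ^ n i))}
  {γ : κ → ℂˣ} (hγ : Function.Injective γ) {m : κ → ℕ} (hm : ∀ i, 1 ≤ m i)
  {θ : ∀ i, LieAlgebra.LieCharacter ℂ
    (polySubalgebra ((Polynomial.X - Polynomial.C (γ i : ℂ)) ^ m i))}
  {V : Type*} [AddCommGroup V] [Module ℂ V] [LieRingModule Virasoro V] [LieModule ℂ Virasoro V]
  {W : Type*} [AddCommGroup W] [Module ℂ W] [LieRingModule Virasoro W] [LieModule ℂ Virasoro W]
  (hV : IsLocallyAnnihilated V) (hW : IsLocallyAnnihilated W)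
  (φ : ((⨂[ℂ] i, polyModule ((Polynomial.X - Polynomial.C (lam i : ℂ)) ^ n i) (μ i)) ⊗[ℂ] V)
          ≃ₗ⁅ℂ, Virasoro⁆
        ((⨂[ℂ] i, polyModule ((Polynomial.X - Polynomial.C (γ i : ℂ)) ^ m i) (θ i)) ⊗[ℂ] W))

include hlam hγ hV hW φ

theorem map_tensorSlot {s : Option ι} {s' : Option κ} (h : s.map lam = s'.map γ)
    (x : Virasoro) (w) : φ (tensorSlot _ V s x w) = tensorSlot _ W s' x (φ w) :=
  (tensorDecomposition hlam μ hV).map_slot (tensorDecomposition hγ θ hW)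
    (fun x w => LieModuleHom.map_lie φ.toLieModuleHom x w) h x w

/-- If λ_i were not among the points of the target, the isomorphism would kill the image of slot i;
but e_0 moves the generator of the i-th factor to a nonzero vector. -/
theorem exists_eq_of_equiv [Nontrivial V] (hn : ∀ i, 1 ≤ n i) (i : ι) : ∃ j, lam i = γ j := by
  by_contra! h
  obtain ⟨u, hu⟩ := exists_ne (0 : V)
  have h1 := (tensorDecomposition hlam μ hV).map_slot_eq_zero (tensorDecomposition hγ θ hW)
    (fun x w => LieModuleHom.map_lie φ.toLieModuleHom x w) (s := some i) (by
      rintro (_ | j) hj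
      · simp [tensorDecomposition] at hj
      · simp only [tensorDecomposition, Option.map_some, Option.some.injEq] at hj
        exact h j hj.symm) (e 0)
      (tensorInsert _ V (fun i => InducedModule.gen _ (μ i)) u i (InducedModule.gen _ (μ i)))
  have h2 : φ (tensorSlot _ V (some i) (e 0)
    (tensorInsert _ V (fun i => InducedModule.gen _ (μ i)) u i (InducedModule.gen _ (μ i)))) = 0 :=
    h1
  rw [← tensorInsert_lie] at h2
  exact tensorInsert_ne_zero (fun i => gen_ne_zero (lam i) (hn i) (μ i)) hu i
    (lie_e_zero_gen_ne_zero (lam i) (hn i) (μ i)) (φ.injective (h2.trans (map_zero φ).symm))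

/-- For n_i > m_j, the element (t - λ_i)^(m_j) would satisfy a nonzero polynomial on each vector of
the target slot, but on no generator of the source slot. -/
theorem le_of_equiv [Nontrivial V] (hn : ∀ i, 1 ≤ n i) (hm : ∀ i, 1 ≤ m i) {i : ι} {j : κ}
    (hij : lam i = γ j) : n i ≤ m j := by
  by_contra! h
  obtain ⟨u, hu⟩ := exists_ne (0 : V)
  have hx := ofLaurent_mem ((Polynomial.X - Polynomial.C (γ j : ℂ)) ^ m j)
  set x := ofLaurent (Polynomial.toLaurent ((Polynomial.X - Polynomial.C (γ j : ℂ)) ^ m j))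
    with hxdef
  obtain ⟨c, hc⟩ := exists_spectral_progression (γ j) (hm j) hx
  set w := tensorInsert (K := ℂ) _ V (fun i => InducedModule.gen _ (μ i)) u i
    (InducedModule.gen _ (μ i)) with hw
  obtain ⟨P, hP, -, hP0⟩ := mem_spectralSubmodule_tensorSlot (X := W)
    (V := fun i => polyModule ((Polynomial.X - Polynomial.C (γ i : ℂ)) ^ m i) (θ i)) (hc (θ j)) (φ w)
  have h0 : φ (Polynomial.aeval (tensorSlot _ V (some i) x) P w) =
      Polynomial.aeval (tensorSlot (K := ℂ) _ W (some j) x) P (φ w) :=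
    LinearMap.map_aeval_apply (φ := φ.toLieModuleHom.toLinearMap)
      (A := tensorSlot (K := ℂ) _ V (some i) x) (B := tensorSlot (K := ℂ) _ W (some j) x)
      (map_tensorSlot hlam hγ hV hW φ (s := some i) (s' := some j) (congrArg some hij) x) P w
  have h1 := φ.injective ((h0.trans hP0).trans (map_zero φ).symm)
  have h2 : tensorInsert (K := ℂ) _ V (fun i => InducedModule.gen _ (μ i)) u i
      (Polynomial.aeval (LieModule.toEnd ℂ Virasoro _ x) P (InducedModule.gen _ (μ i))) =
      Polynomial.aeval (tensorSlot (K := ℂ) _ V (some i) x) P w :=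
    LinearMap.map_aeval_apply (A := LieModule.toEnd ℂ Virasoro _ x)
      (B := tensorSlot (K := ℂ) _ V (some i) x) (tensorInsert_lie _ u i x) P _
  refine tensorInsert_ne_zero (fun i => gen_ne_zero (lam i) (hn i) (μ i)) hu i ?_ (h2.trans h1)
  rw [hxdef, ← hij]
  exact aeval_pow_gen_ne_zero (lam i) h (μ i) hP

/-- In slot i the tensor of generators is an eigenvector of x with eigenvalue μ_i(x), so this value
must occur in the spectrum allowed on the target. -/
theorem exists_character_eq [Nontrivial V] (hn : ∀ i, 1 ≤ n i) {i : ι} {j : κ}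
    (hij : lam i = γ j) {x : Virasoro}
    (hx : x ∈ polySubalgebra ((Polynomial.X - Polynomial.C (lam i : ℂ)) ^ n i))
    (hx' : x ∈ polySubalgebra ((Polynomial.X - Polynomial.C (γ j : ℂ)) ^ m j)) {c : ℂ}
    (hc : ∀ v : polyModule ((Polynomial.X - Polynomial.C (γ j : ℂ)) ^ m j) (θ j),
      v ∈ Module.End.spectralSubmodule (LieModule.toEnd ℂ Virasoro _ x)
        (Set.range fun d : ℕ => θ j ⟨x, hx'⟩ + d * c)) :
    ∃ d : ℕ, θ j ⟨x, hx'⟩ + d * c = μ i ⟨x, hx⟩ := by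
  obtain ⟨u, hu⟩ := exists_ne (0 : V)
  set w := tensorInsert (K := ℂ) _ V (fun i => InducedModule.gen _ (μ i)) u i
    (InducedModule.gen _ (μ i)) with hw
  have hw0 : w ≠ 0 := tensorInsert_ne_zero (fun i => gen_ne_zero (lam i) (hn i) (μ i)) hu i
    (gen_ne_zero (lam i) (hn i) (μ i))
  refine Module.End.eigenvalue_mem_of_mem_spectralSubmodule (mem_spectralSubmodule_tensorSlot
    (X := W) (V := fun i => polyModule ((Polynomial.X - Polynomial.C (γ i : ℂ)) ^ m i) (θ i)) hc
    (φ w)) (fun h => hw0 (φ.injective (h.trans (map_zero φ).symm))) ?_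
  rw [← map_tensorSlot hlam hγ hV hW φ (s := some i) (s' := some j) (congrArg some hij), hw,
    ← tensorInsert_lie, InducedModule.lie_gen hx, map_smul, map_smul]

/-- With t the tensor of generators, the map is v ↦ (f ⊗ 1)(φ(t ⊗ v)). It is equivariant because φ
respects the slots at the point 0, and the functional f is chosen so that a given u ≠ 0 has nonzero
image. -/
theorem exists_hom_ne_zero [Nontrivial V] (hn : ∀ i, 1 ≤ n i) :
    ∃ g : V →ₗ⁅ℂ, Virasoro⁆ W, g ≠ 0 := by
  obtain ⟨u, hu⟩ := exists_ne (0 : V)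
  set t := PiTensorProduct.tprod ℂ (fun i => InducedModule.gen _ (μ i)) with ht
  have ht0 : t ≠ 0 := PiTensorProduct.tprod_ne_zero fun i => gen_ne_zero (lam i) (hn i) (μ i)
  have hw : φ (t ⊗ₜ u) ≠ 0 := fun h => TensorProduct.tmul_ne_zero_of_ne_zero ht0 hu
    (φ.injective (h.trans (map_zero φ).symm))
  obtain ⟨f, hf⟩ := TensorProduct.exists_dual_rTensor_ne_zero hw
  have hlie : ∀ (x : Virasoro) w', TensorProduct.lid ℂ W (LinearMap.rTensor W f
      (tensorSlot (K := ℂ) _ W none x w')) = ⁅x, TensorProduct.lid ℂ W (LinearMap.rTensor W f w')⁆ := by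
    intro x w'
    induction w' using TensorProduct.induction_on with
    | zero => simp
    | add a b ha hb => simp only [map_add, ha, hb, lie_add]
    | tmul t w => simp [tensorSlot_none_tmul]
  refine ⟨{ toLinearMap := (TensorProduct.lid ℂ W).toLinearMap ∘ₗ LinearMap.rTensor W f ∘ₗ
              (φ : _ →ₗ[ℂ] _) ∘ₗ TensorProduct.mk ℂ _ V t
            map_lie' := ?_ }, ?_⟩
  · intro x v
    have h1 := map_tensorSlot hlam hγ hV hW φ (s := none) (s' := none) rfl x (t ⊗ₜ v)
    rw [tensorSlot_none_tmul] at h1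
    exact (congrArg (fun w => TensorProduct.lid ℂ W (LinearMap.rTensor W f w)) h1).trans (hlie x _)
  · intro h
    exact hf (DFunLike.congr_fun h u)

end Isomorphism

/-- Schur's lemma. -/
theorem nonempty_lieModuleEquiv {V : Type*} [AddCommGroup V] [Module ℂ V]
    [LieRingModule Virasoro V] [LieModule ℂ Virasoro V] {W : Type*} [AddCommGroup W] [Module ℂ W]
    [LieRingModule Virasoro W] [LieModule ℂ Virasoro W]
    (hV : LieModule.IsIrreducible ℂ Virasoro V) (hW : LieModule.IsIrreducible ℂ Virasoro W)
    {g : V →ₗ⁅ℂ, Virasoro⁆ W} (hg : g ≠ 0) : Nonempty (V ≃ₗ⁅ℂ, Virasoro⁆ W) := by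
  have hker : g.ker = ⊥ := (eq_bot_or_eq_top g.ker).resolve_right fun h => hg (by
    ext v
    have : v ∈ g.ker := by rw [h]; trivial
    simpa using this)
  have hrange : g.range = ⊤ := (eq_bot_or_eq_top g.range).resolve_left fun h => hg (by
    ext v
    have : g v ∈ g.range := ⟨v, rfl⟩
    rw [h] at this
    simpa using this)
  refine ⟨{ g with
    invFun := (LinearEquiv.ofBijective (g : V →ₗ[ℂ] W) ⟨?_, ?_⟩).symm
    left_inv := ?_
    right_inv := ?_ }⟩
  · exact (LieModuleHom.ker_eq_bot g).mp hker
  · exact (LieModuleHom.range_eq_top g).mp hrange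
  · exact (LinearEquiv.ofBijective (g : V →ₗ[ℂ] W) _).symm_apply_apply
  · exact (LinearEquiv.ofBijective (g : V →ₗ[ℂ] W) _).apply_symm_apply

theorem nontrivial_of_isIrreducible {V : Type*} [AddCommGroup V] [Module ℂ V]
    [LieRingModule Virasoro V] [LieModule ℂ Virasoro V]
    (hV : LieModule.IsIrreducible ℂ Virasoro V) : Nontrivial V := by
  by_contra h
  rw [not_nontrivial_iff_subsingleton] at h
  exact bot_ne_top (α := LieSubmodule ℂ Virasoro V) (Subsingleton.elim _ _)

end Virasoro

/-! ### Comparison with the modules `Ω(lam, b)` -/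

namespace Virasoro

/-- The element e_k multiplies by a monic linear polynomial, translates the variable, which keeps
the top coefficient, and scales by λ^k. The coefficient in degree d + 1 is thus scaled by the value
of x at λ. -/
theorem Omega.act_degree (lam : ℂˣ) (b : ℂ) {p : ℂ[X]} {d : ℕ} (hp : p.natDegree ≤ d)
    (x : Virasoro) : (Omega.act lam b x p).natDegree ≤ d + 1 ∧
      (Omega.act lam b x p).coeff (d + 1) = evalAt lam (toLaurent x) * p.coeff d := by
  rw [eq_ofLaurent_add x]
  simp only [map_add, map_smul, Omega.act_z, smul_zero, add_zero, toLaurent_z, toLaurent_ofLaurent]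
  generalize toLaurent x = q
  induction q using laurent_induction with
  | hadd q r hq hr =>
    rw [map_add, map_add, LinearMap.add_apply, Polynomial.coeff_add, hq.2, hr.2, map_add, add_mul]
    exact ⟨Polynomial.natDegree_add_le_of_degree_le hq.1 hr.1, rfl⟩
  | hT k c =>
    have h1 : (p.comp (Polynomial.X - Polynomial.C (k : ℂ))).natDegree = p.natDegree := by
      rw [Polynomial.natDegree_comp, Polynomial.natDegree_X_sub_C, mul_one]
    have h2 : (p.comp (Polynomial.X - Polynomial.C (k : ℂ))).coeff d = p.coeff d := by
      obtain h | rfl := hp.lt_or_eq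
      · rw [Polynomial.coeff_eq_zero_of_natDegree_lt (h1.trans_lt h),
          Polynomial.coeff_eq_zero_of_natDegree_lt h]
      · have := Polynomial.leadingCoeff_comp (p := p) (q := Polynomial.X - Polynomial.C (k : ℂ))
          (by rw [Polynomial.natDegree_X_sub_C]; exact one_ne_zero)
        rwa [Polynomial.leadingCoeff, h1, Polynomial.leadingCoeff_X_sub_C, one_pow, mul_one] at this
    rw [map_smul, map_smul, LinearMap.smul_apply, ofLaurent_T, Omega.act_e]
    set q := p.comp (Polynomial.X - Polynomial.C (k : ℂ))
    have h3 : q.coeff (d + 1) = 0 := Polynomial.coeff_eq_zero_of_natDegree_lt (by omega)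
    refine ⟨(Polynomial.natDegree_smul_le _ _).trans ((Polynomial.natDegree_smul_le _ _).trans
      (Polynomial.natDegree_mul_le.trans ?_)), ?_⟩
    · rw [Polynomial.natDegree_X_add_C]; omega
    · rw [Polynomial.coeff_smul, Polynomial.coeff_smul, add_mul, Polynomial.coeff_add,
        Polynomial.coeff_X_mul, Polynomial.coeff_C_mul, h3, h2, LaurentPolynomial.smul_eq_C_mul,
        map_mul, LaurentPolynomial.eval₂_T, LaurentPolynomial.eval₂_C]
      simp [mul_assoc]

theorem exists_rootProd {f : ℂ[X]} (hf : f.Monic) (hf0 : f.coeff 0 ≠ 0) :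
    ∃ s : Multiset ℂˣ, f = rootProd s := by
  have h1 : ∀ a ∈ f.roots, IsUnit a := by
    refine fun a ha => isUnit_iff_ne_zero.mpr ?_
    rintro rfl
    rw [Polynomial.mem_roots hf.ne_zero, Polynomial.IsRoot.def,
      ← Polynomial.coeff_zero_eq_eval_zero] at ha
    exact hf0 ha
  have h2 := (IsAlgClosed.splits f).eq_prod_roots_of_monic hf
  lift f.roots to Multiset ℂˣ using h1 with s hs
  refine ⟨s, h2.trans ?_⟩
  rw [rootProd, Multiset.map_map]
  rfl

theorem isEmpty_equiv_omega {f : ℂ[X]} (hf : f.Monic) (hf0 : f.coeff 0 ≠ 0)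
    (hf1 : f.natDegree ≠ 1) (μ : LieAlgebra.LieCharacter ℂ (polySubalgebra f)) (lam : ℂˣ) (b : ℂ) :
    IsEmpty (polyModule f μ ≃ₗ⁅ℂ, Virasoro⁆ Omega lam b) := by
  refine ⟨fun ψ => ?_⟩
  have hlie : ∀ x v, ψ ⁅x, v⁆ = Omega.act lam b x (ψ v) := fun x v =>
    LieModuleHom.map_lie ψ.toLieModuleHom x v
  set p : ℂ[X] := ψ (InducedModule.gen (polySubalgebra f) μ) with hp
  obtain ⟨s, rfl⟩ := exists_rootProd hf hf0
  have heigen : ∀ x (hx : x ∈ polySubalgebra (rootProd s)),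
      Omega.act lam b x p = μ ⟨x, hx⟩ • p := fun x hx => by
    rw [hp, ← hlie, InducedModule.lie_gen hx]
    exact map_smul ψ _ _
  have hspan : ∀ S : Submodule ℂ ℂ[X], p ∈ S → (∀ x, ∀ q ∈ S, Omega.act lam b x q ∈ S) →
      ∀ q, q ∈ S := by
    intro S h1 h2 q
    let Ψ : polyModule (rootProd s) μ →ₗ[ℂ] ℂ[X] := ψ.toLieModuleHom.toLinearMap
    have h3 : Ψ (ψ.symm q) ∈ S :=
      InducedModule.induction (H := polySubalgebra (rootProd s)) (μ := μ) (S := S.comap Ψ) h1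
        (fun x v hv => Eq.subst (motive := fun r : ℂ[X] => r ∈ S) (hlie x v).symm
          (h2 x (Ψ v) hv)) (ψ.symm q)
    exact Eq.subst (motive := fun r : ℂ[X] => r ∈ S) (ψ.apply_symm_apply q) h3
  have hp0 : p ≠ 0 := fun h => by
    have := hspan ⊥ (by simp [h]) (by simp) 1
    simp at this
  -- Without roots, Vir^f is all of Vir and the module would be the line spanned by p, but 1 and X
  -- are linearly independent.
  obtain rfl | hs := eq_or_ne s 0
  · have h1 : ∀ q, q ∈ Submodule.span ℂ {p} := by
      refine hspan _ (Submodule.mem_span_singleton_self p) fun x q hq => ?_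
      obtain ⟨r, rfl⟩ := Submodule.mem_span_singleton.mp hq
      rw [map_smul, heigen x (by simp [rootProd, polySubalgebra_one])]
      exact Submodule.smul_mem _ _ (Submodule.smul_mem _ _ (Submodule.mem_span_singleton_self p))
    obtain ⟨r, hr⟩ := Submodule.mem_span_singleton.mp (h1 1)
    obtain ⟨t, ht⟩ := Submodule.mem_span_singleton.mp (h1 Polynomial.X)
    have hr0 : r ≠ 0 := by rintro rfl; simp at hr
    have h2 : p = Polynomial.C r⁻¹ := by
      rw [← mul_one (Polynomial.C r⁻¹), ← Polynomial.smul_eq_C_mul, ← hr, smul_smul,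
        inv_mul_cancel₀ hr0, one_smul]
    have h3 := congrArg (fun q => Polynomial.coeff q 1) ht
    simp [h2] at h3
  -- The element f multiplies p by a scalar, so the coefficient one degree above the top, f(λ) times
  -- the leading coefficient of p, vanishes.
  · have hroot : evalAt lam (Polynomial.toLaurent (rootProd s)) = 0 := by
      have h1 := (Omega.act_degree lam b (le_refl p.natDegree)
        (ofLaurent (Polynomial.toLaurent (rootProd s)))).2
      rw [heigen _ (ofLaurent_mem _), Polynomial.coeff_smul,
        Polynomial.coeff_eq_zero_of_natDegree_lt (Nat.lt_succ_self _), smul_zero,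
        toLaurent_ofLaurent] at h1
      exact (mul_eq_zero.mp h1.symm).resolve_right (Polynomial.leadingCoeff_ne_zero.mpr hp0)
    have hmem : lam ∈ s := by
      rw [evalAt_toLaurent, rootProd, Polynomial.eval_multiset_prod, Multiset.map_map,
        Multiset.prod_eq_zero_iff] at hroot
      obtain ⟨a, ha, ha'⟩ := Multiset.mem_map.mp hroot
      have : lam = a := Units.ext (by simpa [sub_eq_zero] using ha')
      rwa [this]
    obtain ⟨s₁, rfl⟩ := Multiset.exists_cons_of_mem hmem
    obtain rfl | ⟨a, ha⟩ := s₁.empty_or_exists_mem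
    · exact hf1 (by simp [rootProd])
    obtain ⟨s₂, rfl⟩ := Multiset.exists_cons_of_mem ha
    set g : ℂ[X] := Polynomial.X - Polynomial.C (lam : ℂ) with hg
    set x := ofLaurent (Polynomial.toLaurent g) with hx
    -- The element t - λ vanishes at λ, so it does not raise the degree bound. It restricts to the
    -- polynomials of degree at most that of p, and Cayley–Hamilton applies there.
    have hdeg : ∀ q ∈ Polynomial.degreeLT ℂ (p.natDegree + 1),
        Omega.act lam b x q ∈ Polynomial.degreeLT ℂ (p.natDegree + 1) := by
      intro q hq
      have hq' : q.natDegree ≤ p.natDegree := by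
        rw [Polynomial.mem_degreeLT] at hq
        by_cases h0 : q = 0
        · simp [h0]
        · have := (Polynomial.natDegree_lt_iff_degree_lt h0).mpr hq
          omega
      obtain ⟨h1, h2⟩ := Omega.act_degree lam b hq' x
      rw [hx, toLaurent_ofLaurent, evalAt_toLaurent] at h2
      simp only [hg, Polynomial.eval_sub, Polynomial.eval_X, Polynomial.eval_C, sub_self,
        zero_mul] at h2
      rw [Polynomial.mem_degreeLT, Polynomial.degree_lt_iff_coeff_zero]
      intro k hk
      obtain rfl | hk := hk.eq_or_lt
      · exact h2
      · exact Polynomial.coeff_eq_zero_of_natDegree_lt (by omega)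
    let A := (Omega.act lam b x).restrict hdeg
    have hA : Polynomial.aeval (Omega.act lam b x) A.charpoly p = 0 := by
      have hpmem : p ∈ Polynomial.degreeLT ℂ (p.natDegree + 1) := by
        rw [Polynomial.mem_degreeLT]
        exact Polynomial.degree_le_natDegree.trans_lt (by exact_mod_cast Nat.lt_succ_self _)
      have h1 := LinearMap.map_aeval_apply (φ := (Polynomial.degreeLT ℂ (p.natDegree + 1)).subtype)
        (A := A) (B := Omega.act lam b x) (fun v => rfl) A.charpoly ⟨p, hpmem⟩
      rw [LinearMap.aeval_self_charpoly, LinearMap.zero_apply, map_zero] at h1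
      exact h1.symm
    -- Here g = t - λ and a is a further root, possibly λ itself; it exists because f does not have
    -- degree 1.
    refine aeval_gen_ne_zero (Polynomial.X_sub_C_ne_zero (lam : ℂ)) a s₂ {lam} (by simp [rootProd])
      (by rw [rootProd_cons, rootProd_cons, mul_assoc]) μ A.charpoly_monic.ne_zero ?_
    have h2 : ψ (Polynomial.aeval (LieModule.toEnd ℂ Virasoro (polyModule _ μ) x) A.charpoly
        (InducedModule.gen _ μ)) = Polynomial.aeval (Omega.act lam b x) A.charpoly p :=
      LinearMap.map_aeval_apply (φ := ψ.toLieModuleHom.toLinearMap)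
        (A := LieModule.toEnd ℂ Virasoro (polyModule _ μ) x) (B := Omega.act lam b x)
        (hlie x) A.charpoly _
    exact ψ.injective ((h2.trans hA).trans (map_zero ψ).symm)

end Virasoro

/-! ### Reindexing tensor products -/

section Reindex

variable {K L : Type*} [CommRing K] [LieRing L] [LieAlgebra K L]

theorem PiTensorProduct.reindex_lie {ι κ : Type*} [Fintype ι]
    [DecidableEq ι] [Fintype κ] [DecidableEq κ] (M : ι → Type*) [∀ i, AddCommGroup (M i)]
    [∀ i, Module K (M i)] [∀ i, LieRingModule L (M i)] [∀ i, LieModule K L (M i)] (σ : ι ≃ κ)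
    (x : L) (t : ⨂[K] i, M i) : PiTensorProduct.reindex K M σ ⁅x, t⁆ =
      ⁅x, PiTensorProduct.reindex K M σ t⁆ := by
  change PiTensorProduct.reindex K M σ (lieDiagonal K M x t) =
    lieDiagonal K (fun j => M (σ.symm j)) x (PiTensorProduct.reindex K M σ t)
  induction t using PiTensorProduct.induction_on with
  | smul_tprod r v =>
    simp only [map_smul, lieDiagonal_tprod, map_sum, PiTensorProduct.reindex_tprod]
    congr 1
    refine (Fintype.sum_equiv σ.symm _ _ fun j => ?_).symm
    congr 1
    funext j'
    by_cases h : j' = j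
    · subst h; simp
    · have h' : σ.symm j' ≠ σ.symm j := fun h' => h (σ.symm.injective h')
      simp [h, h']
  | add a b ha hb => simp only [map_add, ha, hb]

theorem TensorProduct.nonempty_lieModuleEquiv {M M' N N' : Type*} [AddCommGroup M] [Module K M]
    [LieRingModule L M] [LieModule K L M] [AddCommGroup M'] [Module K M'] [LieRingModule L M']
    [LieModule K L M'] [AddCommGroup N] [Module K N] [LieRingModule L N] [LieModule K L N]
    [AddCommGroup N'] [Module K N'] [LieRingModule L N'] [LieModule K L N']
    (f : M ≃ₗ[K] M') (hf : ∀ (x : L) v, f ⁅x, v⁆ = ⁅x, f v⁆) (g : N ≃ₗ⁅K, L⁆ N') :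
    Nonempty (M ⊗[K] N ≃ₗ⁅K, L⁆ M' ⊗[K] N') := by
  let g' : N ≃ₗ[K] N' := { g with }
  have hg : ∀ (x : L) v, g' ⁅x, v⁆ = ⁅x, g' v⁆ := LieModuleHom.map_lie g.toLieModuleHom
  refine ⟨{ TensorProduct.congr f g' with map_lie' := ?_ }⟩
  intro x t
  change TensorProduct.congr f g' ⁅x, t⁆ = ⁅x, TensorProduct.congr f g' t⁆
  induction t using TensorProduct.induction_on with
  | zero => simp
  | add a b ha hb => simp only [lie_add, map_add, ha, hb]
  | tmul m n =>
    simp only [TensorProduct.LieModule.lie_tmul_right, map_add, TensorProduct.congr_tmul, hf, hg]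

end Reindex

namespace Virasoro

theorem nonempty_equiv_of_reindex {ι κ : Type*} [Fintype ι] [DecidableEq ι] [Fintype κ]
    [DecidableEq κ] (σ : ι ≃ κ) {lam : ι → ℂˣ} {n : ι → ℕ}
    {μ : ∀ i, LieAlgebra.LieCharacter ℂ
      (polySubalgebra ((Polynomial.X - Polynomial.C (lam i : ℂ)) ^ n i))}
    {γ : κ → ℂˣ} {m : κ → ℕ}
    {θ : ∀ i, LieAlgebra.LieCharacter ℂ
      (polySubalgebra ((Polynomial.X - Polynomial.C (γ i : ℂ)) ^ m i))}
    {V : Type*} [AddCommGroup V] [Module ℂ V] [LieRingModule Virasoro V] [LieModule ℂ Virasoro V]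
    {W : Type*} [AddCommGroup W] [Module ℂ W] [LieRingModule Virasoro W] [LieModule ℂ Virasoro W]
    (g : V ≃ₗ⁅ℂ, Virasoro⁆ W)
    (h : ∀ i, lam i = γ (σ i) ∧ n i = m (σ i) ∧
      ∀ (x : Virasoro)
        (hx : x ∈ polySubalgebra ((Polynomial.X - Polynomial.C (lam i : ℂ)) ^ n i))
        (hx' : x ∈ polySubalgebra ((Polynomial.X - Polynomial.C (γ (σ i) : ℂ)) ^ m (σ i))),
        μ i ⟨x, hx⟩ = θ (σ i) ⟨x, hx'⟩) :
    Nonempty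
      (((⨂[ℂ] i, polyModule ((Polynomial.X - Polynomial.C (lam i : ℂ)) ^ n i) (μ i)) ⊗[ℂ] V)
        ≃ₗ⁅ℂ, Virasoro⁆
      ((⨂[ℂ] i, polyModule ((Polynomial.X - Polynomial.C (γ i : ℂ)) ^ m i) (θ i)) ⊗[ℂ] W)) := by
  -- The characters live on subalgebras depending on the points and exponents, so those are
  -- substituted before the characters are identified.
  obtain rfl : lam = fun i => γ (σ i) := funext fun i => (h i).1
  obtain rfl : n = fun i => m (σ i) := funext fun i => (h i).2.1
  obtain rfl : μ = fun i => θ (σ i) := funext fun i => by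
    refine DFunLike.ext _ _ fun x => ?_
    exact (h i).2.2 x x.2 x.2
  let r := PiTensorProduct.reindex ℂ
    (fun i => polyModule ((Polynomial.X - Polynomial.C (γ i : ℂ)) ^ m i) (θ i)) σ.symm
  refine TensorProduct.nonempty_lieModuleEquiv r.symm (fun x v => ?_) g
  rw [LinearEquiv.symm_apply_eq]
  have h1 := PiTensorProduct.reindex_lie (L := Virasoro) (K := ℂ)
    (fun i => polyModule ((Polynomial.X - Polynomial.C (γ i : ℂ)) ^ m i) (θ i)) σ.symm x (r.symm v)
  exact (h1.trans (congrArg (fun v => ⁅x, v⁆) (r.apply_symm_apply v))).symm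

end Virasoro

end

/-! ### Assembly of the two parts of the theorem -/

theorem mainTheorem3 :
    (∀ (k l : ℕ)
      (lam : Fin k → ℂˣ) (_ : Function.Injective lam) (n : Fin k → ℕ) (_ : ∀ i, 1 ≤ n i)
      (μ : ∀ i, LieAlgebra.LieCharacter ℂ
        (Virasoro.polySubalgebra ((Polynomial.X - Polynomial.C (lam i : ℂ)) ^ n i)))
      (γ : Fin l → ℂˣ) (_ : Function.Injective γ) (m : Fin l → ℕ) (_ : ∀ i, 1 ≤ m i)
      (θ : ∀ i, LieAlgebra.LieCharacter ℂ
        (Virasoro.polySubalgebra ((Polynomial.X - Polynomial.C (γ i : ℂ)) ^ m i)))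
      (V : Type*) [AddCommGroup V] [Module ℂ V] [LieRingModule Virasoro V] [LieModule ℂ Virasoro V]
      (W : Type*) [AddCommGroup W] [Module ℂ W] [LieRingModule Virasoro W] [LieModule ℂ Virasoro W]
      (_ : LieModule.IsIrreducible ℂ Virasoro V) (_ : Virasoro.IsLocallyAnnihilated V)
      (_ : LieModule.IsIrreducible ℂ Virasoro W) (_ : Virasoro.IsLocallyAnnihilated W),
      Nonempty
        (((⨂[ℂ] i, Virasoro.polyModule ((Polynomial.X - Polynomial.C (lam i : ℂ)) ^ n i) (μ i)) ⊗[ℂ] V)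
          ≃ₗ⁅ℂ, Virasoro⁆
        ((⨂[ℂ] i, Virasoro.polyModule ((Polynomial.X - Polynomial.C (γ i : ℂ)) ^ m i) (θ i)) ⊗[ℂ] W)) ↔
      Nonempty (V ≃ₗ⁅ℂ, Virasoro⁆ W) ∧ k = l ∧
        ∃ σ : Fin k ≃ Fin l, ∀ i, lam i = γ (σ i) ∧ n i = m (σ i) ∧
          ∀ (x : Virasoro)
            (hx : x ∈ Virasoro.polySubalgebra ((Polynomial.X - Polynomial.C (lam i : ℂ)) ^ n i))
            (hx' : x ∈ Virasoro.polySubalgebra ((Polynomial.X - Polynomial.C (γ (σ i) : ℂ)) ^ m (σ i))),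
            μ i ⟨x, hx⟩ = θ (σ i) ⟨x, hx'⟩) ∧
    (∀ (f : ℂ[X]) (_ : f.Monic) (_ : f.coeff 0 ≠ 0) (_ : f.natDegree ≠ 1)
      (μ : LieAlgebra.LieCharacter ℂ (Virasoro.polySubalgebra f)) (lam : ℂˣ) (b : ℂ),
      IsEmpty (Virasoro.polyModule f μ ≃ₗ⁅ℂ, Virasoro⁆ Virasoro.Omega lam b)) := by
  refine ⟨?_, fun f hf hf0 hf1 μ lam b => Virasoro.isEmpty_equiv_omega hf hf0 hf1 μ lam b⟩
  intro k l lam hlam n hn μ γ hγ m hm θ V _ _ _ _ W _ _ _ _ hV hVa hW hWa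
  have hVn := Virasoro.nontrivial_of_isIrreducible hV
  have hWn := Virasoro.nontrivial_of_isIrreducible hW
  constructor
  · rintro ⟨φ⟩
    obtain ⟨g, hg⟩ := Virasoro.exists_hom_ne_zero hlam hγ hVa hWa φ hn
    refine ⟨Virasoro.nonempty_lieModuleEquiv hV hW hg, ?_⟩
    choose s hs using Virasoro.exists_eq_of_equiv hlam hγ hVa hWa φ hn
    choose t ht using Virasoro.exists_eq_of_equiv hγ hlam hWa hVa φ.symm hm
    let σ : Fin k ≃ Fin l :=
      { toFun := s
        invFun := t
        left_inv := fun i => hlam (by rw [← ht, ← hs])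
        right_inv := fun j => hγ (by rw [← hs, ← ht]) }
    refine ⟨Fin.equiv_iff_eq.mp ⟨σ⟩, σ, fun i => ?_⟩
    have hi : lam i = γ (σ i) := hs i
    have hnm : n i = m (σ i) := le_antisymm
      (Virasoro.le_of_equiv hlam hγ hVa hWa φ hn hm hi)
      (Virasoro.le_of_equiv hγ hlam hWa hVa φ.symm hm hn hi.symm)
    refine ⟨hi, hnm, fun x hx hx' => ?_⟩
    obtain ⟨c, hc⟩ := Virasoro.exists_spectral_progression (lam i) (hn i) hx
    have hc' : ∀ v, v ∈ Module.End.spectralSubmodule (LieModule.toEnd ℂ Virasoro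
        (Virasoro.polyModule _ (θ (σ i))) x) (Set.range fun d : ℕ => θ (σ i) ⟨x, hx'⟩ + d * c) := by
      -- The point and the exponent are generalized so that the equalities can be substituted in the
      -- dependent type of ν. The step c is the same for μ and θ.
      have key : ∀ (a : ℂˣ) (r : ℕ), a = lam i → r = n i → ∀ hx'' ν v,
          v ∈ Module.End.spectralSubmodule (LieModule.toEnd ℂ Virasoro
            (Virasoro.polyModule ((Polynomial.X - Polynomial.C (a : ℂ)) ^ r) ν) x)
            (Set.range fun d : ℕ => ν ⟨x, hx''⟩ + d * c) := by
        rintro _ _ rfl rfl hx'' ν v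
        exact hc ν v
      exact key _ _ hi.symm hnm.symm hx' (θ (σ i))
    obtain ⟨d, hd⟩ := Virasoro.exists_character_eq hlam hγ hVa hWa φ hn hi hx hx' hc'
    obtain ⟨d', hd'⟩ := Virasoro.exists_character_eq hγ hlam hWa hVa φ.symm hm hi.symm hx' hx
      (hc (μ i))
    -- The two differences d c = μ(x) - θ(x) and d' c = θ(x) - μ(x) cancel. With d, d' natural
    -- numbers and characteristic zero, either c = 0 or d = 0.
    have h1 : ((d + d' : ℕ) : ℂ) * c = 0 := by
      push_cast
      linear_combination hd + hd'
    rcases mul_eq_zero.mp h1 with h2 | h2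
    · have : d = 0 := by
        have := Nat.cast_eq_zero.mp h2
        omega
      rw [← hd, this]
      simp
    · rw [← hd, h2]
      simp
  · rintro ⟨⟨g⟩, -, σ, h⟩
    exact Virasoro.nonempty_equiv_of_reindex σ g h
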